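/- **Conventions.** Let $T$ be a complete first-order theory in a language $\mathcal L$ (of any cardinality). For a structure $\mathcal M$ with universe $M$ and $A\subseteq M$, let $\operatorname{acl}(A)$ be the set of all elements of $M$ that lie in some finite $A$-definable subset of $M$. $T$ is *geometric* if in every model $\mathcal M\models T$: (i) (exchange) for all $a,b\in M$ and $A\subseteq M$, if $b\in\operatorname{acl}(A\cup\{a\})\setminus\operatorname{acl}(A)$ then $a\in\operatorname{acl}(A\cup\{b\})$; and (ii) (elimination of $\exists^\infty$) for every $\mathcal L$-formula $\psi(x,\bar y)$, $x$ a single variable, there is $k\in\mathbb N$ such that for every tuple $\bar b$ of elements of $M$, if $\psi(x,\bar b)$ has more than $k$ solutions in $M$, then it has infinitely many. For a finite tuple $a$ and a set $A$, $\dim(a/A)$ is the least cardinality of a subtuple $a'$ of $a$ with $\operatorname{acl}(a\cup A)=\operatorname{acl}(a'\cup A)$. For sets $A,B,C\subseteq M$, write $A\perp_C B$ if $\dim(a/B\cup C)=\dim(a/C)$ for every finite tuple $a$ of elements of $A$. A geometric theory $T$ is *weakly locally modular* if for every saturated $\mathcal M\models T$ and all small $A,B\subseteq M$ there is a small $C\subseteq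 M$ with $C\perp_\emptyset A\cup B$ and $A\perp_{\operatorname{acl}(A\cup C)\cap\operatorname{acl}(B\cup C)}B$. Here, as usual, saturated means $\kappa$-saturated for an uncountable cardinal $\kappa>|\mathcal L|$, small means of cardinality less than $\kappa$, and the condition is required for all such $\kappa$. For sets $V_1,\dots,V_r$, a *finite $r$-grid* in $V_1\times\dots\times V_r$ is a product $B=B_1\times\dots\times B_r$ of finite sets $B_i\subseteq V_i$, and $$\delta^r_{r-1}(B)=\sum_{i=1}^{r}\ \prod_{j\ne i}|B_j| .$$ A set $X\subseteq V_1\times\dots\times V_r$ is *$K_{k,\dots,k}$-free* if it contains no grid $C_1\times\dots\times C_r$ with $|C_i|=k$ for all $i$. **Theorem.** Let $T$ be a geometric, weakly locally modular theory, let $r\ge 2$, and let $\varphi(\bar x_1,\dots,\bar x_r,\bar y)$ be an $\mathcal L$-formula without parameters, with $|\bar x_i|=d_i$ and $|\bar y|=e$. Then there is a real number $\alpha>0$, depending only on $T$ and $\varphi$, such that the following holds for every model $\mathcal M\models T$. For $b\in M^e$ let $$E_b=\{(a_1,\dots,a_r)\in M^{d_1}\times\dots\times M^{d_r}:\ \mathcal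 M\models\varphi(a_1,\dots,a_r,b)\}.$$ Then for every $b\in M^e$ exactly one of the following two cases occurs: 1. for every $k\in\mathbb N$, $E_b$ is not $K_{k,\dots,k}$-free; 2. for every finite $r$-grid $B\subseteq\prod_{i=1}^r M^{d_i}$, $$|E_b\cap B|\le \alpha\,\delta^r_{r-1}(B).$$ -/

import Mathlib

open FirstOrder
open scoped Cardinal

universe u v w

namespace GeometricTheory

section Closure

variable (L : FirstOrder.Language.{u, v}) {M : Type w} [L.Structure M]

/-- The algebraic closure of `A`: the elements lying in some finite `A`-definable subset of `M`. -/
def acl (A : Set M) : Set M :=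
  {a | ∃ S : Set M, A.Definable₁ L S ∧ S.Finite ∧ a ∈ S}

/-- `dim(s / A)`: the least cardinality of a subtuple `t` of `s` such that
`acl(t ∪ A) = acl(s ∪ A)`. A finite tuple enters only through its finite set `s` of entries. -/
noncomputable def dim (s : Finset M) (A : Set M) : ℕ :=
  sInf {n | ∃ t : Finset M, t ⊆ s ∧ t.card = n ∧
    acl L ((t : Set M) ∪ A) = acl L ((s : Set M) ∪ A)}

/-- `Indep L A C B`: the set `A` is independent from `B` over `C`, i.e.
`dim(a / BC) = dim(a / C)` for every finite tuple `a` of elements of `A`. -/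
def Indep (A C B : Set M) : Prop :=
  ∀ s : Finset M, (s : Set M) ⊆ A → dim L s (B ∪ C) = dim L s C

variable (M) in
/-- `κ`-saturation: over every parameter set `A ⊆ M` with `|A| < κ`, every set of formulas
`p(x₁, …, xₙ)` with parameters in `A` that is finitely satisfiable in `M` is realized in `M`. -/
def IsSaturated (κ : Cardinal.{w}) : Prop :=
  ∀ A : Set M, #A < κ → ∀ (n : ℕ) (p : Set (L[[A]].Formula (Fin n))),
    (∀ F : Finset (L[[A]].Formula (Fin n)), (F : Set (L[[A]].Formula (Fin n))) ⊆ p →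
      ∃ x : Fin n → M, ∀ ψ ∈ F, ψ.Realize x) →
    ∃ x : Fin n → M, ∀ ψ ∈ p, ψ.Realize x

variable (M) in
/-- The exchange principle for algebraic closure in `M`. -/
def Exchange : Prop :=
  ∀ (A : Set M) (a b : M), b ∈ acl L (insert a A) → b ∉ acl L A → a ∈ acl L (insert b A)

variable (M) in
/-- Elimination of the quantifier "there exist infinitely many" in `M`. -/
def EliminatesExistsInfty : Prop :=
  ∀ (n : ℕ) (φ : L.Formula (Fin 1 ⊕ Fin n)), ∃ k : ℕ, ∀ b : Fin n → M,
    (k : ℕ∞) < {x : M | φ.Realize (Sum.elim (fun _ => x) b)}.encard →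
    {x : M | φ.Realize (Sum.elim (fun _ => x) b)}.Infinite

end Closure

/-- A geometric theory: a complete theory in all of whose models algebraic closure satisfies
exchange and the quantifier "there exist infinitely many" is eliminated. -/
def IsGeometric {L : FirstOrder.Language.{u, v}} (T : L.Theory) : Prop :=
  T.IsComplete ∧
    ∀ (M : Type (max u v)) [L.Structure M] [Nonempty M], M ⊨ T →
      Exchange L M ∧ EliminatesExistsInfty L M

/-- Weak local modularity. "Saturated" means `κ`-saturated for an uncountable cardinal
`κ > |L|`, and a subset is small if its cardinality is less than `κ`. -/
def IsWeaklyLocallyModular {L : FirstOrder.Language.{u, v}} (T : L.Theory) : Prop :=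
  ∀ κ : Cardinal.{max u v}, ℵ₀ < κ → L.card < κ →
    ∀ (M : Type (max u v)) [L.Structure M] [Nonempty M], M ⊨ T → IsSaturated L M κ →
      ∀ A B : Set M, #A < κ → #B < κ →
        ∃ C : Set M, #C < κ ∧ Indep L C ∅ (A ∪ B) ∧
          Indep L A (acl L (A ∪ C) ∩ acl L (B ∪ C)) B

end GeometricTheory

namespace Grid

section

variable {r : ℕ} {V : Fin r → Type w}

/-- The finite `r`-grid `B₁ × ⋯ × B_r`. -/
def prod (B : ∀ i, Finset (V i)) : Set (∀ i, V i) :=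
  {a | ∀ i, a i ∈ B i}

/-- `δ_j^r(B)`: the sum over all `i₁ < ⋯ < i_j` of the products `|B_{i₁}| ⋯ |B_{i_j}|`. -/
def delta (j : ℕ) (B : ∀ i, Finset (V i)) : ℕ :=
  ∑ S ∈ (Finset.univ : Finset (Fin r)).powersetCard j, ∏ i ∈ S, (B i).card

/-- `X` is `K_{k₁, …, k_r}`-free: it contains no grid `C₁ × ⋯ × C_r` with `|C_i| = k_i`. -/
def IsKFree (k : Fin r → ℕ) (X : Set (∀ i, V i)) : Prop :=
  ¬ ∃ C : ∀ i, Finset (V i), (∀ i, (C i).card = k i) ∧ prod C ⊆ X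

end

/-- The relation `E_b` defined by `φ(x̄₁, …, x̄_r, b)`, where `x̄_i` is a `d i`-tuple. -/
def definedRel {L : FirstOrder.Language.{u, v}} {M : Type w} [L.Structure M] {r e : ℕ} {d : Fin r → ℕ}
    (φ : L.Formula ((Σ i : Fin r, Fin (d i)) ⊕ Fin e)) (b : Fin e → M) :
    Set (∀ i : Fin r, Fin (d i) → M) :=
  {a | φ.Realize (Sum.elim (fun p => a p.1 p.2) b)}

end Grid

/-! The argument compares two ways of measuring the lines of the relation `E`, where a line in
direction `i` fixes all components but the `i`-th. Elimination of `∃^∞` gives one bound `K` for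
which a line with more than `K` points of `E` has an infinite projection to some coordinate. The
derivative of `E` keeps the points all of whose lines have more than `K` points of `E`. Inside a
grid, at most `K` points per line are lost, hence at most `K * delta (r - 1) B` in total.

Derive `∑ d i + 1` times. If nothing survives, the losses add up to the linear bound, with a
constant independent of the parameters. If a point survives, work in a saturated model. While some
component is algebraic over the parameters and the other components, it can be moved along its line
to one with a coordinate outside the closure of the rest; this costs one derivative and raises the
rank of the point. The rank is at most `∑ d i`, so eventually a point of `E` has no component
algebraic over the others (`exists_forall_notMem_acl_of_deriveIter`).

From such a point, weak local modularity produces grids (`exists_grid_of_forall_notMem_acl`): each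
component is replaced in turn by `k` generic copies, and independence over an intersection of
closures keeps the remaining components non-algebraic. For each `k` the implication "the last
derivative is nonempty, hence there is a grid of size `k`" is a sentence, and passes from the
saturated model to all models by completeness. Grids of size `k` for all `k` contradict a linear
bound, so the cases exclude each other. -/

/-! ### Iterated products of an ultrafilter along a well-order. -/

section IteratedUltrafilter

open Filter Set Function

variable {O J : Type*} [LinearOrder O]

theorem apply_update_of_dependsOn_Iio {β γ : O} {p : (O → J) → Prop} (hp : DependsOn p (Iio β))
    (h : β ≤ γ) (x : O → J) (j : J) : p (Function.update x γ j) = p x :=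
  hp fun _ hi => Function.update_of_ne (ne_of_lt (lt_of_lt_of_le hi h)) _ _

variable [WellFoundedLT O]

open Classical in
/-- The iterated products of an ultrafilter `D` along a well-order: the `α`-th one decides a
property depending on coordinates `≤ β`, for `β < α`, by first choosing the coordinate `β`
with respect to `D`, and then the coordinates below `β`. -/
noncomputable def iteratedUltrafilter (D : Ultrafilter J) : O → Ultrafilter (O → J) :=
  WellFounded.fix (r := ((· < ·) : O → O → Prop)) wellFounded_lt fun α U =>
    if _h : Nonempty (Iio α) then
      (Ultrafilter.of (atTop : Filter (Iio α))).bind fun γ =>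
        D.bind fun j => (U γ.1 γ.2).map fun x => update x γ.1 j
    else pure fun _ => (D.nonempty_of_mem univ_mem).some

theorem eventually_iteratedUltrafilter (D : Ultrafilter J) (α : O) [Nonempty (Iio α)]
    (p : (O → J) → Prop) :
    (∀ᶠ x in (iteratedUltrafilter D α : Filter (O → J)), p x) ↔
      ∀ᶠ γ in (Ultrafilter.of (atTop : Filter (Iio α)) : Filter (Iio α)), ∀ᶠ j in (D : Filter J),
        ∀ᶠ x in (iteratedUltrafilter D γ.1 : Filter (O → J)), p (update x γ.1 j) := by
  conv_lhs => rw [iteratedUltrafilter, WellFounded.fix_eq, dif_pos (by infer_instance)]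
  rfl

/-- Coherence of the products: the coordinate `γ` to be updated is eventually at least `β`, where
`p` does not see it. This also makes the arbitrary choice of an ultrafilter above `atTop` harmless.
-/
theorem eventually_iteratedUltrafilter_of_le (D : Ultrafilter J) {p : (O → J) → Prop} {β : O}
    (hp : DependsOn p (Iio β)) (α : O) (h : β ≤ α) :
    (∀ᶠ x in (iteratedUltrafilter D α : Filter (O → J)), p x) ↔
      ∀ᶠ x in (iteratedUltrafilter D β : Filter (O → J)), p x := by
  induction α using WellFoundedLT.induction with
  | ind α ih =>
    rcases h.eq_or_lt with rfl | h
    · rfl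
    have : Nonempty (Iio α) := ⟨⟨β, h⟩⟩
    rw [eventually_iteratedUltrafilter]
    have hev : ∀ᶠ γ in (Ultrafilter.of (atTop : Filter (Iio α)) : Filter (Iio α)),
        (⟨β, h⟩ : Iio α) ≤ γ := Ultrafilter.of_le _ (eventually_ge_atTop _)
    rw [eventually_congr (q := fun _ => ∀ᶠ x in (iteratedUltrafilter D β : Filter (O → J)), p x)]
    · simp
    · filter_upwards [hev] with γ hγ
      simp only [apply_update_of_dependsOn_Iio hp (show β ≤ γ.1 from hγ), eventually_const]
      exact ih γ.1 γ.2 hγ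

theorem eventually_iteratedUltrafilter_of_covBy (D : Ultrafilter J) {p : (O → J) → Prop} {β α : O}
    (h : β ⋖ α) :
    (∀ᶠ x in (iteratedUltrafilter D α : Filter (O → J)), p x) ↔
      ∀ᶠ j in (D : Filter J),
        ∀ᶠ x in (iteratedUltrafilter D β : Filter (O → J)), p (update x β j) := by
  have : Nonempty (Iio α) := ⟨⟨β, h.lt⟩⟩
  rw [eventually_iteratedUltrafilter]
  have hev : ∀ᶠ γ in (Ultrafilter.of (atTop : Filter (Iio α)) : Filter (Iio α)),
      (⟨β, h.lt⟩ : Iio α) ≤ γ := Ultrafilter.of_le _ (eventually_ge_atTop _)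
  rw [eventually_congr (q := fun _ => ∀ᶠ j in (D : Filter J),
    ∀ᶠ x in (iteratedUltrafilter D β : Filter (O → J)), p (update x β j))]
  · simp
  · filter_upwards [hev] with γ hγ
    obtain rfl : γ.1 = β := le_antisymm (h.le_of_lt γ.2) hγ
    rfl

/-- The limit of the iterated products of `D`. -/
noncomputable def limitUltrafilter [Nonempty O] (D : Ultrafilter J) : Ultrafilter (O → J) :=
  (Ultrafilter.of (atTop : Filter O)).bind (iteratedUltrafilter D)

theorem eventually_limitUltrafilter [Nonempty O] (D : Ultrafilter J) {p : (O → J) → Prop} {β : O}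
    (hp : DependsOn p (Iio β)) :
    (∀ᶠ x in (limitUltrafilter (O := O) D : Filter (O → J)), p x) ↔
      ∀ᶠ x in (iteratedUltrafilter D β : Filter (O → J)), p x := by
  have hev : ∀ᶠ γ in (Ultrafilter.of (atTop : Filter O) : Filter O), β ≤ γ :=
    Ultrafilter.of_le _ (eventually_ge_atTop _)
  change (∀ᶠ γ in (Ultrafilter.of (atTop : Filter O) : Filter O), ∀ᶠ x in
    (iteratedUltrafilter D γ : Filter (O → J)), p x) ↔ _
  rw [eventually_congr (q := fun _ => ∀ᶠ x in (iteratedUltrafilter D β : Filter (O → J)), p x)]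
  · simp
  · filter_upwards [hev] with γ hγ
    exact eventually_iteratedUltrafilter_of_le D hp γ hγ

/-- Coordinate `β` is chosen before the coordinates below it, so a property known for almost every
fixed `j` can be evaluated at `j = x β`. Saturation rests on this diagonal step. -/
theorem eventually_limitUltrafilter_apply [Nonempty O] [NoMaxOrder O] (D : Ultrafilter J)
    {p : J → (O → J) → Prop} {β : O} (hp : ∀ j, DependsOn (p j) (Iio β))
    (h : ∀ᶠ j in (D : Filter J), ∀ᶠ x in (limitUltrafilter (O := O) D : Filter (O → J)), p j x) :
    ∀ᶠ x in (limitUltrafilter (O := O) D : Filter (O → J)), p (x β) x := by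
  obtain ⟨α, hα⟩ : ∃ α, β ⋖ α := by
    have hne : (Ioi β).Nonempty := exists_gt β
    refine ⟨wellFounded_lt.min (Ioi β) hne, wellFounded_lt.min_mem _ hne, fun γ h1 h2 => ?_⟩
    exact wellFounded_lt.not_lt_min (Ioi β) h1 h2
  have hq : DependsOn (fun x => p (x β) x) (Iio α) := by
    intro x y hxy
    simp only [hxy β hα.lt]
    exact hp _ fun i hi => hxy i (lt_trans hi hα.lt)
  rw [eventually_limitUltrafilter D hq, eventually_iteratedUltrafilter_of_covBy D hα]
  filter_upwards [h] with j hj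
  simp only [update_self, apply_update_of_dependsOn_Iio (hp _) le_rfl]
  exact (eventually_limitUltrafilter D (hp j)).1 hj

end IteratedUltrafilter

/-! ### Saturated models as limits of iterated ultrapowers. -/

section SaturatedModel

open Filter Set FirstOrder.Language

variable (L : FirstOrder.Language.{u, v}) (M : Type*) [L.Structure M]
  {O J : Type*} [LinearOrder O] [WellFoundedLT O] [Nonempty O]

/-- The substructure of the ultrapower by the limit of the iterated products of `D` that consists
of the classes of the functions depending on a proper initial segment of the coordinates. -/
noncomputable def limitUltrapower (D : Ultrafilter J) :
    L.Substructure ((limitUltrafilter (O := O) D : Filter (O → J)).Product fun _ => M) where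
  carrier := {a | ∃ f : (O → J) → M, (∃ β, DependsOn f (Iio β)) ∧ a = f}
  fun_mem := by
    intro n F x hx
    choose f hf hxf using hx
    choose β hβ using hf
    obtain ⟨γ, hγ⟩ := Finite.exists_le β
    refine ⟨fun k => Structure.funMap F fun i => f i k, ⟨γ, fun k l hkl => ?_⟩, ?_⟩
    · simp only
      congr 1
      ext i
      exact hβ i fun j hj => hkl j (lt_of_lt_of_le hj (hγ i))
    · obtain rfl : x = fun i => (f i : (limitUltrafilter (O := O) D : Filter (O → J)).Product
        fun _ => M) := funext hxf
      exact Ultraproduct.funMap_cast F f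

/-- Tarski–Vaught test: by Łoś, a Skolem function applied pointwise to the representatives of the
parameters gives a witness, which depends only on the coordinates that they depend on. -/
theorem isElementary_limitUltrapower [Nonempty M] (D : Ultrafilter J) :
    (limitUltrapower L M (O := O) D).IsElementary := by
  refine Substructure.isElementary_of_exists _ fun n φ x a ha => ?_
  choose f hf hxf using fun i => (x i).2
  choose β hβ using hf
  obtain ⟨γ, hγ⟩ := Finite.exists_le β
  obtain ⟨g, rfl⟩ := Quotient.exists_rep a
  have key : ∀ g : (O → J) → M, φ.Realize default (Fin.snoc (Subtype.val ∘ x)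
      (g : (limitUltrafilter (O := O) D : Filter (O → J)).Product fun _ => M) : Fin (n + 1) → _) ↔
      ∀ᶠ k in (limitUltrafilter (O := O) D : Filter (O → J)),
        φ.Realize default (Fin.snoc (fun i => f i k) (g k) : Fin (n + 1) → M) := by
    intro g
    have := Ultraproduct.boundedFormula_realize_cast
      (u := limitUltrafilter (O := O) D) (M := fun _ => M) φ
      (fun i => i.elim) (Fin.snoc (α := fun _ => (O → J) → M) f g)
    have h1 : ∀ k, (fun i => (Fin.snoc (α := fun _ => (O → J) → M) f g) i k) =
        (Fin.snoc (fun i => f i k) (g k) : Fin (n + 1) → M) := by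
      intro k
      ext i
      refine Fin.lastCases ?_ (fun i => ?_) i <;> simp
    have h2 : (fun i => ((Fin.snoc (α := fun _ => (O → J) → M) f g) i :
        (limitUltrafilter (O := O) D : Filter (O → J)).Product fun _ => M)) =
        (Fin.snoc (Subtype.val ∘ x) (g : (limitUltrafilter (O := O) D : Filter (O → J)).Product
          fun _ => M) : Fin (n + 1) → _) := by
      ext i
      refine Fin.lastCases ?_ (fun i => ?_) i
      · rw [Fin.snoc_last]
        exact (Fin.snoc_last (α := fun _ => (limitUltrafilter (O := O) D :
          Filter (O → J)).Product fun _ => M) _ _).symm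
      · rw [Fin.snoc_castSucc]
        exact (hxf i).symm.trans (Fin.snoc_castSucc (α := fun _ => (limitUltrafilter (O := O) D :
          Filter (O → J)).Product fun _ => M) _ (Subtype.val ∘ x) i).symm
    rw [h2] at this
    simp only [h1] at this
    rw [Subsingleton.elim (fun i : Empty => (((i.elim : (O → J) → M)) :
      (limitUltrafilter (O := O) D : Filter (O → J)).Product fun _ => M)) default] at this
    refine this.trans (eventually_congr (Eventually.of_forall fun k => ?_))
    rw [Subsingleton.elim (fun i : Empty => (i.elim : (O → J) → M) k) default]
  let h : (Fin n → M) → M := fun v => Classical.epsilon fun m =>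
    φ.Realize default (Fin.snoc v m : Fin (n + 1) → M)
  refine ⟨⟨((fun k => h fun i => f i k : (O → J) → M) :
    (limitUltrafilter (O := O) D : Filter (O → J)).Product fun _ => M), _, ⟨γ, ?_⟩, rfl⟩, ?_⟩
  · intro k l hkl
    simp only
    congr 1
    ext i
    exact hβ i fun j hj => hkl j (lt_of_lt_of_le hj (hγ i))
  · refine (key _).2 ?_
    filter_upwards [(key g).1 ha] with k hk
    exact Classical.epsilon_spec (p := fun m =>
      φ.Realize default (Fin.snoc (fun i => f i k) m : Fin (n + 1) → M)) ⟨_, hk⟩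

/-- The limit ultrapower as an elementary substructure of the ultrapower. -/
noncomputable def elementaryLimitUltrapower [Nonempty M] (D : Ultrafilter J) :
    L.ElementarySubstructure ((limitUltrafilter (O := O) D : Filter (O → J)).Product fun _ => M) :=
  ⟨limitUltrapower L M D, isElementary_limitUltrapower L M D⟩

end SaturatedModel

section

open Filter Set FirstOrder.Language

variable (L : FirstOrder.Language.{u, v}) (M : Type w) [L.Structure M] [Nonempty M]
  {O Λ : Type w} [LinearOrder O] [WellFoundedLT O] [Nonempty O] [NoMaxOrder O]

/-- A type over few parameters is realized with the help of a coordinate `β` that none of their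
representatives uses: the value at `β` is a finite set of codes, and the realization satisfies,
pointwise, the finite part of the type that it codes. As `D` refines `atTop`, every formula is
eventually included. -/
theorem isSaturated_elementaryLimitUltrapower (D : Ultrafilter (Finset Λ))
    (hD : (D : Filter (Finset Λ)) ≤ atTop) {κ : Cardinal.{w}}
    (hO : ∀ S : Set O, #S < κ → ∃ β, ∀ γ ∈ S, γ < β)
    (hΛ : ∀ A : Set (elementaryLimitUltrapower L M (O := O) D), #A < κ → ∀ n,
      Nonempty (L[[A]].Formula (Fin n) ↪ Λ)) :
    GeometricTheory.IsSaturated L (elementaryLimitUltrapower L M (O := O) D) κ := by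
  intro A hA n p hp
  obtain ⟨code⟩ := hΛ A hA n
  choose rep hrep hcoe using fun a : elementaryLimitUltrapower L M (O := O) D => a.2
  choose bound hbound using hrep
  obtain ⟨β, hβ⟩ := hO (bound '' A) (Cardinal.mk_image_le.trans_lt hA)
  let tr : L[[A]].Formula (Fin n) → L.Formula (A ⊕ Fin n) := BoundedFormula.constantsVarsEquiv
  have key : ∀ (ψ : L[[A]].Formula (Fin n)) (x : Fin n → elementaryLimitUltrapower L M (O := O) D)
      (g : Fin n → (O → Finset Λ) → M), (∀ i, (x i).1 = g i) → (ψ.Realize x ↔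
        ∀ᶠ k in (limitUltrafilter (O := O) D : Filter (O → Finset Λ)),
          (tr ψ).Realize (Sum.elim (fun a => rep a k) fun i => g i k)) := by
    intro ψ x g hg
    have h1 : ψ.Realize x ↔ (tr ψ).Realize (Sum.elim (fun a : A => a.1) x) := by
      rw [Formula.Realize, ← BoundedFormula.realize_constantsVarsEquiv]
      rfl
    rw [h1, ← (elementaryLimitUltrapower L M (O := O) D).subtype.map_formula]
    have := Ultraproduct.realize_formula_cast (u := limitUltrafilter (O := O) D)
      (M := fun _ => M) (tr ψ) (Sum.elim (fun a => rep a) g)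
    have h2 : (fun i => ((Sum.elim (fun a : A => rep a) g) i :
        (limitUltrafilter (O := O) D : Filter (O → Finset Λ)).Product fun _ => M)) =
        (elementaryLimitUltrapower L M (O := O) D).subtype ∘ Sum.elim (fun a : A => a.1) x := by
      ext i
      rcases i with a | i
      · exact (hcoe a.1).symm
      · exact (hg i).symm
    rw [h2] at this
    refine this.trans (eventually_congr (Eventually.of_forall fun k => ?_))
    rw [iff_iff_eq]
    congr 1
    ext i
    rcases i <;> rfl
  -- For parameter values `c` at which the fragment `F` is not satisfiable the value is arbitrary;
  -- finite satisfiability makes these negligible.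
  let G : Finset Λ → (A → M) → Fin n → M := fun F c => Classical.epsilon fun v =>
    ∀ ψ ∈ p, code ψ ∈ F → (tr ψ).Realize (Sum.elim c v)
  have hdep : ∀ k l : O → Finset Λ, (∀ i ∈ Iio β, k i = l i) →
      (fun a : A => rep a k) = fun a : A => rep a l := by
    intro k l hkl
    ext a
    exact hbound a.1 fun i hi => hkl i (lt_trans hi (hβ _ ⟨a, a.2, rfl⟩))
  obtain ⟨α, hα⟩ := exists_gt β
  refine ⟨fun i => ⟨((fun k => G (k β) (fun a => rep a k) i : (O → Finset Λ) → M) :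
    (limitUltrafilter (O := O) D : Filter (O → Finset Λ)).Product fun _ => M), _, ⟨α, ?_⟩, rfl⟩, ?_⟩
  · intro k l hkl
    simp only
    rw [hdep k l fun i hi => hkl i (lt_trans hi hα), hkl β hα]
  intro ψ hψ
  refine (key ψ _ (fun i k => G (k β) (fun a => rep a k) i) fun i => rfl).2 ?_
  let q : Finset Λ → (O → Finset Λ) → Prop := fun F k => code ψ ∈ F ∧
    ∃ v, ∀ θ ∈ p, code θ ∈ F → (tr θ).Realize (Sum.elim (fun a => rep a k) v)
  have hq : ∀ᶠ k in (limitUltrafilter (O := O) D : Filter (O → Finset Λ)), q (k β) k := by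
    refine eventually_limitUltrafilter_apply D (fun F k l hkl => ?_) ?_
    · simp only [q, hdep k l hkl]
    · filter_upwards [hD (eventually_ge_atTop {code ψ})] with F hF
      have hfin : {θ | θ ∈ p ∧ code θ ∈ F}.Finite :=
        (F.finite_toSet.preimage code.injective.injOn).subset fun θ hθ => hθ.2
      obtain ⟨x, hx⟩ := hp hfin.toFinset fun θ hθ => by
        have := hfin.mem_toFinset.1 hθ
        exact this.1
      have : ∀ᶠ k in (limitUltrafilter (O := O) D : Filter (O → Finset Λ)), ∀ θ ∈ hfin.toFinset,
          (tr θ).Realize (Sum.elim (fun a => rep a k) fun i => rep (x i) k) :=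
        (Finset.eventually_all _).2 fun θ hθ =>
          (key θ x (fun i => rep (x i)) fun i => hcoe (x i)).1 (hx θ hθ)
      filter_upwards [this] with k hk
      exact ⟨Finset.singleton_subset_iff.1 hF, _, fun θ h1 h2 =>
        hk θ (hfin.mem_toFinset.2 ⟨h1, h2⟩)⟩
  filter_upwards [hq] with k hk
  exact Classical.epsilon_spec (p := fun v => ∀ θ ∈ p, code θ ∈ k β →
    (tr θ).Realize (Sum.elim (fun a => rep a k) v)) hk.2 ψ hψ hk.1

end

/-- Take `κ` to be the successor of `l = max ℵ₀ |L|`. It is regular, so fewer than `κ` stages are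
bounded, and fewer than `κ` parameters are at most `l` many, so `l` codes suffice for the formulas
over them. -/
theorem exists_isSaturated_model {L : FirstOrder.Language.{u, v}} {T : L.Theory} (hT : T.IsSatisfiable) :
    ∃ κ : Cardinal.{max u v}, ℵ₀ < κ ∧ L.card < κ ∧
      ∃ (M : Type (max u v)) (_ : L.Structure M) (_ : Nonempty M),
        M ⊨ T ∧ GeometricTheory.IsSaturated L M κ := by
  obtain ⟨M⟩ := hT
  set l : Cardinal.{max u v} := max ℵ₀ L.card
  have hreg : (Order.succ l).IsRegular := Cardinal.isRegular_succ (le_max_left _ _)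
  have : Nonempty (Order.succ l).ord.ToType := by
    rw [← Order.cof_ne_zero_iff, Ordinal.cof_toType, hreg.cof_ord]
    exact hreg.ne_zero
  have hcof : Order.cof (Order.succ l).ord.ToType = Order.succ l := by
    rw [Ordinal.cof_toType, hreg.cof_ord]
  have : NoMaxOrder (Order.succ l).ord.ToType := by
    have : NoTopOrder (Order.succ l).ord.ToType := by
      rw [← Order.one_lt_cof_iff, hcof]
      exact Cardinal.one_lt_aleph0.trans_le hreg.aleph0_le
    exact NoTopOrder.to_noMaxOrder _
  let D : Ultrafilter (Finset l.out) := Ultrafilter.of Filter.atTop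
  refine ⟨Order.succ l, (le_max_left _ _).trans_lt (Order.lt_succ l),
    (le_max_right _ _).trans_lt (Order.lt_succ l),
    elementaryLimitUltrapower L M (O := (Order.succ l).ord.ToType) D, inferInstance,
    inferInstance, ?_, ?_⟩
  · rw [FirstOrder.Language.ElementarySubstructure.theory_model_iff,
      FirstOrder.Language.Theory.model_iff]
    exact fun φ hφ => (FirstOrder.Language.Ultraproduct.sentence_realize φ).2
      (Filter.Eventually.of_forall fun _ => FirstOrder.Language.Theory.realize_sentence_of_mem T hφ)
  · refine isSaturated_elementaryLimitUltrapower L M D (Ultrafilter.of_le _) (fun S hS => ?_)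
      fun A hA n => ?_
    · rw [← not_isCofinal_iff]
      intro h
      exact hS.not_ge (hcof.symm.trans_le (Order.cof_le h))
    · rw [← Cardinal.lift_mk_le']
      have h1 : #((L[[A]]).Formula (Fin n)) ≤ #(Σ n', (L[[A]]).BoundedFormula (Fin n) n') :=
        Cardinal.mk_le_of_injective (f := fun ψ => ⟨0, ψ⟩) fun ψ θ h => by simpa using h
      have h2 := h1.trans FirstOrder.Language.BoundedFormula.card_le
      have h3 : #A ≤ l := Order.lt_succ_iff.1 hA
      have h4 : l + l = l := Cardinal.add_eq_self (le_max_left _ _)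
      have h5 : (L[[A]]).card ≤ l := by
        rw [FirstOrder.Language.card_withConstants]
        simp only [Cardinal.lift_id]
        exact (add_le_add (le_max_right _ _) h3).trans h4.le
      simp only [Cardinal.lift_id, Cardinal.lift_uzero, Cardinal.mk_fin, Cardinal.lift_natCast,
        Cardinal.mk_out] at h2 ⊢
      refine h2.trans (max_le (le_max_left _ _) ?_)
      exact (add_le_add ((Cardinal.natCast_lt_aleph0.le).trans (le_max_left _ _)) h5).trans h4.le

/-! ### Counting solutions by formulas, and definable families. -/

section Counting

theorem Set.natCast_lt_encard_iff {X : Type*} {s : Set X} {n : ℕ} :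
    (n : ℕ∞) < s.encard ↔ ∃ f : Fin (n + 1) → X, Function.Injective f ∧ ∀ i, f i ∈ s := by
  rw [← Order.add_one_le_iff_of_not_isMax (by simp)]
  constructor
  · intro h
    obtain ⟨t, hts, ht⟩ := Set.exists_subset_encard_eq h
    have hfin : t.Finite := Set.finite_of_encard_eq_coe (k := n + 1) (by simpa using ht)
    have hc : hfin.toFinset.card = n + 1 := by
      have := hfin.encard_eq_coe_toFinset_card
      rw [ht] at this
      exact_mod_cast this.symm
    let e := hfin.toFinset.equivFinOfCardEq hc
    exact ⟨fun i => (e.symm i).1, Subtype.val_injective.comp e.symm.injective,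
      fun i => hts (hfin.mem_toFinset.1 (e.symm i).2)⟩
  · rintro ⟨f, hf, hfs⟩
    have h := Set.encard_le_encard (Set.range_subset_iff.2 hfs)
    rw [← Set.image_univ, hf.encard_image, Set.encard_univ, ENat.card_eq_coe_fintype_card, Fintype.card_fin] at h
    exact_mod_cast h

namespace FirstOrder.Language

variable {L : FirstOrder.Language.{u, v}} {α β : Type*}

/-- The formula expressing that `φ` has more than `n` solutions. -/
noncomputable def Formula.exsGT [Finite β] (n : ℕ) (φ : L.Formula (α ⊕ β)) : L.Formula α :=
  Formula.iExs (Fin (n + 1) × β)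
    ((Formula.iInf fun i : Fin (n + 1) => φ.relabel (Sum.map id fun b => (i, b))) ⊓
      Formula.iInf fun p : {p : Fin (n + 1) × Fin (n + 1) // p.1 ≠ p.2} =>
        (Formula.iInf fun b : β => Term.equal (Term.var (Sum.inr (p.1.1, b)))
          (Term.var (Sum.inr (p.1.2, b)))).not)

theorem Formula.realize_exsGT {M : Type*} [L.Structure M] [Finite β] (n : ℕ)
    (φ : L.Formula (α ⊕ β)) (v : α → M) :
    (φ.exsGT n).Realize v ↔ (n : ℕ∞) < {u : β → M | φ.Realize (Sum.elim v u)}.encard := by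
  rw [Set.natCast_lt_encard_iff, Formula.exsGT, Formula.realize_iExs]
  have hrel : ∀ (f : Fin (n + 1) → β → M) (i : Fin (n + 1)),
      (Sum.elim v (fun p : Fin (n + 1) × β => f p.1 p.2)) ∘ (Sum.map id fun b => (i, b)) =
        Sum.elim v (f i) := by
    intro f i
    ext x
    rcases x <;> rfl
  constructor
  · rintro ⟨f, hf⟩
    refine ⟨fun i b => f (i, b), fun i j hij => ?_, fun i => ?_⟩
    · by_contra hne
      have := hf
      simp only [Formula.realize_inf, Formula.realize_iInf, Formula.realize_not,
        Formula.realize_equal, Term.realize_var, Sum.elim_inr, Subtype.forall] at this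
      exact this.2 (i, j) hne fun b => congrFun hij b
    · have := (Formula.realize_inf.1 hf).1
      rw [Formula.realize_iInf] at this
      have := this i
      rw [Formula.realize_relabel] at this
      exact (congrArg φ.Realize (hrel (fun i b => f (i, b)) i)).mp this
  · rintro ⟨f, hf, hfs⟩
    refine ⟨fun p => f p.1 p.2, Formula.realize_inf.2 ⟨?_, ?_⟩⟩
    · rw [Formula.realize_iInf]
      intro i
      rw [Formula.realize_relabel, hrel]
      exact hfs i
    · simp only [Formula.realize_iInf, Formula.realize_not,
        Formula.realize_equal, Term.realize_var, Sum.elim_inr, Subtype.forall]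
      intro p hp h
      exact hp (hf (funext h))

end FirstOrder.Language

namespace Set

open FirstOrder.Language

variable {L : FirstOrder.Language.{u, v}} {M : Type w} [L.Structure M] {α β ι : Type*} {A B : Set M}

theorem Definable.natCast_lt_encard [Finite β] {S : Set (α ⊕ β → M)} (hS : A.Definable L S)
    (n : ℕ) :
    A.Definable L {v : α → M | (n : ℕ∞) < {u : β → M | Sum.elim v u ∈ S}.encard} := by
  obtain ⟨φ, rfl⟩ := hS
  refine ⟨φ.exsGT n, ?_⟩
  ext v
  exact (Formula.realize_exsGT n φ v).symm

/-- Parameters can be replaced by variables. -/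
theorem Definable.exists_of_union_range {τ : ι → M} {S : Set (β → M)}
    (hS : (A ∪ range τ).Definable L S) :
    ∃ R : Set (ι ⊕ β → M), A.Definable L R ∧ ∀ u, Sum.elim τ u ∈ R ↔ u ∈ S := by
  obtain ⟨φ, rfl⟩ := definable_iff_exists_formula_sum.1 hS
  have : ∀ a : (A ∪ range τ : Set M), ∃ x : A ⊕ ι, Sum.elim Subtype.val τ x = a := by
    rintro ⟨a, ha | ⟨i, rfl⟩⟩
    · exact ⟨Sum.inl ⟨a, ha⟩, rfl⟩
    · exact ⟨Sum.inr i, rfl⟩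
  choose g hg using this
  refine ⟨_, definable_iff_exists_formula_sum.2 ⟨φ.relabel (Sum.elim
    (fun a => Sum.map id Sum.inl (g a)) fun b => Sum.inr (Sum.inr b)), rfl⟩, fun u => ?_⟩
  simp only [mem_ofPred_eq, Formula.realize_relabel]
  rw [iff_iff_eq]
  congr 1
  ext x
  rcases x with a | b
  · rw [Sum.elim_inl, ← hg a]
    simp only [Function.comp_apply, Sum.elim_inl]
    rcases g a <;> rfl
  · rfl

theorem Definable.fiber [Finite ι] [Finite β] {R : Set (ι ⊕ β → M)} (hR : A.Definable L R)
    (hAB : A ⊆ B) {z : ι → M} (hz : ∀ i, z i ∈ B) :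
    B.Definable L {u : β → M | Sum.elim z u ∈ R} := by
  refine Definable.preimage_map (F := fun u => Sum.elim z u) (fun i => ?_) (hR.mono hAB)
  rcases i with i | i
  · exact definableFun_const L β (hz i)
  · exact DefinableFun.proj L

end Set

end Counting

namespace GeometricTheory

open Set FirstOrder.Language

/-! ### Algebraic closure and dimension. -/

section Basic

variable {L : FirstOrder.Language.{u, v}} {M : Type w} [L.Structure M] {A B D : Set M}

theorem acl_mono (h : A ⊆ B) : acl L A ⊆ acl L B :=
  fun _ ⟨S, hS, hfin, hx⟩ => ⟨S, Definable.mono hS h, hfin, hx⟩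

theorem subset_acl : A ⊆ acl L A :=
  fun a ha => ⟨{a}, Definable.singleton_of_mem L ha, finite_singleton a, rfl⟩

theorem exists_finset_of_mem_acl {x : M} (hx : x ∈ acl L A) :
    ∃ A₀ : Finset M, (A₀ : Set M) ⊆ A ∧ x ∈ acl L (A₀ : Set M) := by
  obtain ⟨S, hS, hfin, hx⟩ := hx
  obtain ⟨A₀, hA₀, h⟩ := definable_iff_finitely_definable.1 hS
  exact ⟨A₀, hA₀, S, h, hfin, hx⟩

theorem mem_acl_of_finite {ι : Type*} {S : Set (ι → M)} (hS : A.Definable L S) (hfin : S.Finite)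
    {x : ι → M} (hx : x ∈ S) [Finite ι] (i : ι) : x i ∈ acl L A := by
  refine ⟨(fun f => f i) '' S, ?_, hfin.image _, mem_image_of_mem _ hx⟩
  have := hS.image_comp (fun _ : Fin 1 => i)
  refine (congrArg (A.Definable L) (ext fun f => ?_)).mpr this
  constructor
  · rintro ⟨g, hg, h⟩
    refine ⟨g, hg, ?_⟩
    ext j
    rw [Subsingleton.elim j 0]
    exact h
  · rintro ⟨g, hg, rfl⟩
    exact ⟨g, hg, rfl⟩

/-- An element algebraic over `A` and a tuple `τ` lies in a uniformly finite `A`-definable family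
parametrized by tuples. -/
theorem exists_definable_finite_fibers {ι : Type*} {τ : ι → M} {x : M}
    (hx : x ∈ acl L (A ∪ range τ)) :
    ∃ R : Set (ι ⊕ Fin 1 → M), A.Definable L R ∧ Sum.elim τ (fun _ => x) ∈ R ∧
      ∀ z : ι → M, {u : Fin 1 → M | Sum.elim z u ∈ R}.Finite := by
  obtain ⟨S, hS, hfin, hx⟩ := hx
  obtain ⟨R, hR, h⟩ := Definable.exists_of_union_range hS
  have hfin' : {u : Fin 1 → M | Sum.elim τ u ∈ R}.Finite := by
    refine Finite.of_finite_image (f := fun u => u 0) (hfin.subset ?_) fun f _ g _ hfg => ?_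
    · rintro _ ⟨u, hu, rfl⟩
      exact (h u).1 hu
    · ext j
      rw [Subsingleton.elim j 0]
      exact hfg
  obtain ⟨n, hn⟩ : ∃ n : ℕ, {u : Fin 1 → M | Sum.elim τ u ∈ R}.encard = n :=
    ⟨_, hfin'.encard_eq_coe⟩
  -- Fibers larger than the one over `τ` are discarded; for the fixed number `n` this is a definable
  -- condition.
  refine ⟨R ∩ {w | (w ∘ Sum.inl) ∉ {z : ι → M | (n : ℕ∞) < {u | Sum.elim z u ∈ R}.encard}},
    hR.inter ((hR.natCast_lt_encard n).compl.preimage_comp Sum.inl),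
    ⟨(h _).2 hx, ?_⟩, fun z => ?_⟩
  · simp [hn]
  · by_cases hz : (n : ℕ∞) < {u : Fin 1 → M | Sum.elim z u ∈ R}.encard
    · convert finite_empty (α := Fin 1 → M)
      ext u
      simp [hz]
    · exact (finite_of_encard_le_coe (not_lt.1 hz)).subset fun u hu => hu.1

/-- Only finitely many parameters from the closure matter. Letting each vary in a finite
`A`-definable set, in a family all of whose fibers are finite, gives a finite `A`-definable set
containing `x`. -/
theorem acl_acl : acl L (acl L A) = acl L A := by
  refine Subset.antisymm (fun x hx => ?_) subset_acl
  obtain ⟨A₀, hA₀, hx⟩ := exists_finset_of_mem_acl hx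
  obtain ⟨R, hR, hxR, hfin⟩ := exists_definable_finite_fibers (L := L) (A := ∅)
    (τ := fun a : A₀ => (a : M)) (x := x) (by simpa using! hx)
  choose S hS hSfin hS' using fun a : A₀ => hA₀ a.2
  have hdef : A.Definable L {w : Fin 1 ⊕ A₀ → M |
      (∀ a, w (Sum.inr a) ∈ S a) ∧ w ∘ Sum.swap ∈ R} := by
    refine Definable.inter (f := {w | ∀ a, w (Sum.inr a) ∈ S a}) ?_
      ((hR.mono (empty_subset A)).preimage_comp Sum.swap)
    rw [ofPred_forall]
    exact definable_iInter_of_finite fun a => (hS a).preimage_comp fun _ => Sum.inr a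
  have := mem_acl_of_finite hdef.exists_of_finite ?_ (x := fun _ => x) ?_ 0
  · exact this
  · refine ((Finite.pi' hSfin).biUnion fun z _ => hfin z).subset ?_
    rintro u ⟨z, hz, h⟩
    refine mem_biUnion (x := z) hz ?_
    refine (congrArg (· ∈ R) (funext fun i => ?_)).mp h
    rcases i <;> rfl
  · refine ⟨fun a => a, hS', ?_⟩
    refine (congrArg (· ∈ R) (funext fun i => ?_)).mp hxR
    rcases i <;> rfl

theorem acl_subset_iff : acl L A ⊆ acl L B ↔ A ⊆ acl L B :=
  ⟨fun h => subset_acl.trans h, fun h => (acl_mono h).trans acl_acl.subset⟩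

theorem mem_acl_of_subset {x : M} (hx : x ∈ acl L A) (h : A ⊆ acl L B) : x ∈ acl L B :=
  acl_subset_iff.2 h hx

theorem mem_acl_of_definable_fiber {ι : Type*} [Finite ι] {R : Set (ι ⊕ Fin 1 → M)}
    (hR : A.Definable L R) {z : ι → M} (hfin : {u : Fin 1 → M | Sum.elim z u ∈ R}.Finite) {x : M}
    (hx : Sum.elim z (fun _ => x) ∈ R) : x ∈ acl L (A ∪ range z) :=
  mem_acl_of_finite (x := fun _ => x)
    (hR.fiber subset_union_left fun i => Or.inr (mem_range_self i)) hfin hx 0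

open Classical in
/-- A minimal subtuple generating `s` over `D` stays independent over `B ∪ D` when
`dim(s / B ∪ D) = dim(s / D)`. -/
theorem exists_basis_of_dim_eq {s : Finset M} (h : dim L s (B ∪ D) = dim L s D) :
    ∃ t : Finset M, t ⊆ s ∧ (s : Set M) ⊆ acl L (t ∪ D) ∧
      ∀ x ∈ t, x ∉ acl L ((t : Set M) \ {x} ∪ (B ∪ D)) := by
  obtain ⟨t, hts, htc, ht⟩ := Nat.sInf_mem (s := {n | ∃ t : Finset M, t ⊆ s ∧ t.card = n ∧
    acl L ((t : Set M) ∪ D) = acl L ((s : Set M) ∪ D)}) ⟨_, s, subset_rfl, rfl, rfl⟩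
  have hst : (s : Set M) ⊆ acl L (t ∪ D) := ht ▸ subset_union_left.trans subset_acl
  refine ⟨t, hts, hst, fun x hx hmem => ?_⟩
  -- If `x` were algebraic over the rest, `t` without `x` would still generate `s` over `B ∪ D`,
  -- making the dimension drop.
  have hle : dim L s (B ∪ D) ≤ (t.erase x).card := by
    refine Nat.sInf_le ⟨_, (t.erase_subset x).trans hts, rfl, ?_⟩
    rw [Finset.coe_erase]
    have h1 : (t : Set M) ⊆ acl L ((t : Set M) \ {x} ∪ (B ∪ D)) := by
      intro y hy
      by_cases hyx : y = x
      · exact hyx ▸ hmem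
      · exact subset_acl (Or.inl ⟨hy, hyx⟩)
    refine Subset.antisymm (acl_mono (union_subset_union_left _ (sdiff_subset.trans
      (Finset.coe_subset.2 hts)))) (acl_subset_iff.2 (union_subset ?_ ?_))
    · exact hst.trans (acl_subset_iff.2 (union_subset h1
        ((subset_union_right.trans subset_union_right).trans subset_acl)))
    · exact subset_union_right.trans subset_acl
  rw [h] at hle
  have := Finset.card_erase_lt_of_mem hx
  have h2 : t.card = dim L s D := htc
  omega

end Basic

/-! ### Consequences of exchange. -/

section Exchange

variable {L : FirstOrder.Language.{u, v}} {M : Type w} [L.Structure M]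

/-- The entries of `t` are independent over `Z`. -/
def IndepSet (L : FirstOrder.Language.{u, v}) [L.Structure M] (t : Finset M) (Z : Set M) : Prop :=
  ∀ x ∈ t, x ∉ acl L ((t : Set M) \ {x} ∪ Z)

/-- Steinitz: move the generators into the base one at a time. If adding `j` to the base spoils the
independence of `I`, dropping one element `x` restores it, since otherwise exchange would make `j`,
and then `x`, algebraic over the rest of `I`. -/
theorem IndepSet.card_le [DecidableEq M] (hex : Exchange L M) (J : Finset M) :
    ∀ (I : Finset M) (Z : Set M), IndepSet L I Z → (I : Set M) ⊆ acl L (J ∪ Z) →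
      I.card ≤ J.card := by
  induction J using Finset.induction with
  | empty =>
    intro I Z hI hIZ
    rw [Finset.card_empty, Nat.le_zero, Finset.card_eq_zero]
    refine Finset.eq_empty_of_forall_notMem fun x hx => hI x hx ?_
    refine acl_mono ?_ (hIZ hx)
    simp
  | insert j J hj ih =>
    intro I Z hI hIZ
    rw [Finset.card_insert_of_notMem hj]
    have hspan : (I : Set M) ⊆ acl L (J ∪ insert j Z) := by
      refine hIZ.trans (acl_mono ?_)
      rw [Finset.coe_insert, insert_union, union_insert]
    by_cases hind : IndepSet L I (insert j Z)
    · exact (ih I _ hind hspan).trans (Nat.le_succ _)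
    simp only [IndepSet, not_forall, not_not] at hind
    obtain ⟨x, hx, hxI⟩ := hind
    have hjx : j ∉ acl L ((I : Set M) \ {x} ∪ Z) := by
      intro h
      refine hI x hx (mem_acl_of_subset hxI ?_)
      rw [union_insert]
      exact insert_subset h subset_acl
    have := ih (I.erase x) (insert j Z) (fun y hy h => ?_) (fun y hy => hspan ?_)
    · rw [Finset.card_erase_of_mem hx] at this
      omega
    · rw [Finset.coe_erase, union_insert] at h
      rw [Finset.mem_erase] at hy
      refine hjx ?_
      have h2 := hex _ _ _ h fun h3 => hI y hy.2 (acl_mono ?_ h3)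
      · refine acl_mono ?_ h2
        refine insert_subset (Or.inl ⟨hy.2, hy.1⟩) (union_subset_union_left _ sdiff_subset)
      · exact union_subset_union_left _ (sdiff_subset_sdiff_left sdiff_subset)
    · exact Finset.mem_of_mem_erase hy

theorem IndepSet.insert [DecidableEq M] (hex : Exchange L M) {J : Finset M} {Z : Set M}
    (hJ : IndepSet L J Z) {x : M} (hx : x ∉ acl L (J ∪ Z)) : IndepSet L (insert x J) Z := by
  have hxJ : x ∉ J := fun h => hx (subset_acl (Or.inl h))
  intro y hy h
  rw [Finset.coe_insert] at h
  rcases Finset.mem_insert.1 hy with rfl | hy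
  · refine hx (acl_mono (union_subset_union_left _ ?_) h)
    rintro z ⟨rfl | hz, hne⟩
    exacts [absurd rfl hne, hz]
  · have hne : x ≠ y := fun h => hxJ (h ▸ hy)
    rw [insert_sdiff_of_notMem _ (by simpa using hne), insert_union] at h
    refine hx (acl_mono ?_ (hex _ _ _ h (hJ y hy)))
    exact insert_subset (Or.inl hy) (union_subset_union_left _ sdiff_subset)

/-- A finite set contains an independent set generating it. -/
theorem exists_indepSet_spanning [DecidableEq M] (hex : Exchange L M) (s : Finset M) (Z : Set M) :
    ∃ J ⊆ s, IndepSet L J Z ∧ (s : Set M) ⊆ acl L (J ∪ Z) := by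
  induction s using Finset.induction with
  | empty => exact ⟨∅, subset_rfl, by simp [IndepSet], by simp⟩
  | insert x s hx ih =>
    obtain ⟨J, hJs, hJ, hs⟩ := ih
    by_cases hxJ : x ∈ acl L (J ∪ Z)
    · refine ⟨J, hJs.trans (Finset.subset_insert _ _), hJ, ?_⟩
      rw [Finset.coe_insert]
      exact insert_subset hxJ hs
    · refine ⟨_, Finset.insert_subset_insert x hJs, hJ.insert hex hxJ, ?_⟩
      rw [Finset.coe_insert, Finset.coe_insert]
      refine insert_subset (subset_acl (Or.inl (mem_insert _ _))) (hs.trans (acl_mono ?_))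
      exact union_subset_union_left _ (subset_insert _ _)

/-- If `C` is independent from `X` over `∅`, then adding `C` to subsets of `X` does not make
elements of `X` algebraic. -/
theorem mem_acl_of_indep_empty (hex : Exchange L M) {C X Y : Set M} (hC : Indep L C ∅ X)
    (hY : Y ⊆ X) {x : M} (hx : x ∈ X) (h : x ∈ acl L (Y ∪ C)) : x ∈ acl L Y := by
  classical
  obtain ⟨A₀, hA₀, hx₀⟩ := exists_finset_of_mem_acl h
  set c := A₀.filter (· ∈ C)
  obtain ⟨t, -, htc, ht⟩ := exists_basis_of_dim_eq (hC c fun y hy => by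
    exact (Finset.mem_filter.1 hy).2)
  simp only [union_empty] at htc ht
  have hxt : x ∈ acl L (t ∪ Y) := by
    refine mem_acl_of_subset hx₀ fun y hy => ?_
    by_cases hyC : y ∈ C
    · exact acl_mono subset_union_left (htc (Finset.mem_filter.2 ⟨hy, hyC⟩))
    · exact subset_acl (Or.inr ((hA₀ hy).resolve_right hyC))
  -- The elements of `t` are removed one by one: if some `y` were needed, exchange would make it
  -- algebraic over `X` and the rest of `t`.
  have key : ∀ t' ⊆ t, x ∈ acl L ((t' : Finset M) ∪ Y) → x ∈ acl L Y := by
    intro t'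
    induction t' using Finset.induction with
    | empty => simp
    | insert y t' hy ih =>
      intro ht' hxy
      have hyt : y ∈ t := ht' (Finset.mem_insert_self _ _)
      refine ih ((Finset.subset_insert _ _).trans ht') ?_
      by_contra hcon
      rw [Finset.coe_insert, insert_union] at hxy
      refine ht y hyt (acl_mono ?_ (hex _ _ _ hxy hcon))
      refine insert_subset (Or.inr hx) (union_subset ?_ (hY.trans subset_union_right))
      exact fun z hz => Or.inl ⟨ht' (Finset.mem_insert_of_mem hz), fun h => hy (h ▸ hz)⟩
  exact key t subset_rfl hxt

end Exchange

/-! ### Non-algebraic elements in saturated models. -/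

section Saturated

variable {L : FirstOrder.Language.{u, v}} {M : Type w} [L.Structure M]

/-- Realize the set of all formulas that fail at only finitely many points of `S`. It is finitely
satisfiable because `S` is infinite, and it contains the complement of every finite `Q`-definable
set. -/
theorem exists_notMem_acl_of_infinite {κ : Cardinal.{w}} (hκ : ℵ₀ < κ) (hsat : IsSaturated L M κ)
    {S : Set M} (hS : (univ : Set M).Definable₁ L S) (hinf : S.Infinite) {Q : Set M} (hQ : #Q < κ) :
    ∃ x ∈ S, x ∉ acl L Q := by
  obtain ⟨A₀, -, hA₀⟩ := definable_iff_finitely_definable.1 hS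
  have hA : #(Q ∪ A₀ : Set M) < κ := (Cardinal.mk_union_le _ _).trans_lt
    (Cardinal.add_lt_of_lt hκ.le hQ ((Cardinal.lt_aleph0_of_finite _).trans hκ))
  obtain ⟨x, hx⟩ := hsat (Q ∪ A₀) hA 1
    {ψ | (S ∩ {x | ¬ ψ.Realize fun _ => x}).Finite} fun F hF => by
      have : (S \ ⋃ ψ ∈ F, (S ∩ {x | ¬ ψ.Realize fun _ => x})).Nonempty :=
        (hinf.sdiff (F.finite_toSet.biUnion fun ψ hψ => hF hψ)).nonempty
      obtain ⟨x, hxS, hx⟩ := this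
      refine ⟨fun _ => x, fun ψ hψ => ?_⟩
      by_contra hcon
      exact hx (mem_biUnion hψ ⟨hxS, hcon⟩)
  have hconst : x = fun _ => x 0 := by
    ext i
    rw [Subsingleton.elim i 0]
  obtain ⟨θ, hθ⟩ := hA₀.mono (subset_union_right : (A₀ : Set M) ⊆ Q ∪ A₀)
  have hθ' : ∀ y, θ.Realize y ↔ y 0 ∈ S := fun y => by
    have := congrArg (y ∈ ·) hθ
    simpa using this.symm
  refine ⟨x 0, (hθ' x).1 (hx θ ?_), ?_⟩
  · refine finite_empty.subset fun y hy => hy.2 ((hθ' _).2 hy.1)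
  · rintro ⟨S', hS', hfin, hx'⟩
    obtain ⟨ψ, hψ⟩ := Definable.mono hS' (subset_union_left : Q ⊆ Q ∪ A₀)
    have hψ' : ∀ y, ψ.Realize y ↔ y 0 ∈ S' := fun y => by
      have := congrArg (y ∈ ·) hψ
      simpa using this.symm
    have := hx ψ.not (hfin.subset fun y hy => by simpa [hψ'] using hy.2)
    rw [Formula.realize_not, hψ'] at this
    exact this hx'

end Saturated

end GeometricTheory

namespace GeometricTheory

open Set FirstOrder.Language

/-! ### Uniform bounds from elimination of `∃^∞`. -/

section Elimination

variable {L : FirstOrder.Language.{u, v}} {M : Type w} [L.Structure M] {α β : Type*}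

theorem EliminatesExistsInfty.exists_bound_one (h : EliminatesExistsInfty L M) [Finite α]
    (φ : L.Formula (α ⊕ Fin 1)) :
    ∃ K : ℕ, ∀ v : α → M, (K : ℕ∞) < {x : M | φ.Realize (Sum.elim v fun _ => x)}.encard →
      {x : M | φ.Realize (Sum.elim v fun _ => x)}.Infinite := by
  obtain ⟨n, ⟨e⟩⟩ := Finite.exists_equiv_fin α
  obtain ⟨K, hK⟩ := h n (φ.relabel (Sum.elim (Sum.inr ∘ e) Sum.inl))
  refine ⟨K, fun v => ?_⟩
  have := hK (v ∘ e.symm)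
  have hv : ∀ x : M, (Sum.elim (fun _ : Fin 1 => x) (v ∘ e.symm)) ∘
      (Sum.elim (Sum.inr ∘ e) Sum.inl) = Sum.elim v fun _ : Fin 1 => x := by
    intro x
    ext i
    rcases i <;> simp
  simpa only [Formula.realize_relabel, hv] using this

theorem EliminatesExistsInfty.exists_bound (h : EliminatesExistsInfty L M) [Finite α] [Finite β]
    (φ : L.Formula (α ⊕ β)) :
    ∃ K : ℕ, ∀ v : α → M, (K : ℕ∞) < {u : β → M | φ.Realize (Sum.elim v u)}.encard →
      ∃ l, ((fun u : β → M => u l) '' {u | φ.Realize (Sum.elim v u)}).Infinite := by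
  classical
  have := Fintype.ofFinite β
  let ψ : β → L.Formula (α ⊕ Fin 1) := fun l => Formula.iExs β
    (φ.relabel (Sum.map Sum.inl id) ⊓
      Term.equal (Term.var (Sum.inr l)) (Term.var (Sum.inl (Sum.inr 0))))
  have hψ : ∀ l v, {x : M | (ψ l).Realize (Sum.elim v fun _ => x)} =
      (fun u : β → M => u l) '' {u | φ.Realize (Sum.elim v u)} := by
    intro l v
    ext x
    simp only [ψ, mem_ofPred_eq, Formula.realize_iExs, Formula.realize_inf,
      Formula.realize_relabel, Formula.realize_equal, Term.realize_var, Sum.elim_inr,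
      Sum.elim_inl, mem_image]
    refine exists_congr fun u => and_congr_left fun _ => ?_
    rw [iff_iff_eq]
    congr 1
    ext i
    rcases i <;> rfl
  choose K hK using fun l => h.exists_bound_one (ψ l)
  -- If all projections of the fiber are finite, they have at most `K l` elements each, and the
  -- fiber lies in their product.
  refine ⟨∏ l, K l, fun v hv => ?_⟩
  by_contra! hcon
  have hle : ∀ l, ((fun u : β → M => u l) '' {u | φ.Realize (Sum.elim v u)}).encard ≤ K l := by
    intro l
    by_contra! hlt
    have := hK l v
    rw [hψ] at this
    exact this hlt (hcon l)
  have hsub : {u : β → M | φ.Realize (Sum.elim v u)} ⊆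
      (Fintype.piFinset fun l => (hcon l).toFinset : Finset (β → M)) := by
    intro u hu
    simp only [Finset.mem_coe, Fintype.mem_piFinset, Finite.mem_toFinset]
    exact fun l => mem_image_of_mem _ hu
  have h1 := encard_le_encard hsub
  rw [encard_coe_eq_coe_finsetCard, Fintype.card_piFinset] at h1
  refine absurd hv (not_lt.2 (h1.trans ?_))
  rw [Nat.cast_le]
  refine Finset.prod_le_prod' fun l _ => ?_
  have := hle l
  rw [(hcon l).encard_eq_coe_toFinset_card] at this
  exact_mod_cast this

theorem EliminatesExistsInfty.definable_setOf_infinite (h : EliminatesExistsInfty L M) [Finite α]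
    {A : Set M} {S : Set (α ⊕ Fin 1 → M)} (hS : A.Definable L S) :
    A.Definable L {v : α → M | {x : M | Sum.elim v (fun _ => x) ∈ S}.Infinite} := by
  obtain ⟨A₀, hA₀, hS₀⟩ := definable_iff_finitely_definable.1 hS
  obtain ⟨φ, rfl⟩ := definable_iff_exists_formula_sum.1 hS₀
  obtain ⟨K, hK⟩ := h.exists_bound_one (α := A₀ ⊕ α)
    (φ.relabel (Equiv.sumAssoc _ _ _).symm)
  have hrel : ∀ (v : α → M) (x : M), Sum.elim (Sum.elim (fun a : A₀ => (a : M)) v)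
      (fun _ : Fin 1 => x) ∘ (Equiv.sumAssoc _ _ _).symm =
      Sum.elim (fun a : A₀ => (a : M)) (Sum.elim v fun _ => x) := by
    intro v x
    ext i
    rcases i with i | i | i <;> rfl
  have himg : ∀ v : α → M, {u : Fin 1 → M | Sum.elim v u ∈
      {w | φ.Realize (Sum.elim (fun a : A₀ => (a : M)) w)}} = (fun x _ => x) ''
      {x : M | φ.Realize (Sum.elim (fun a : A₀ => (a : M)) (Sum.elim v fun _ => x))} := by
    intro v
    ext u
    constructor
    · intro hu
      have hc : u = fun _ => u 0 := funext fun i => by rw [Subsingleton.elim i 0]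
      refine ⟨u 0, ?_, hc.symm⟩
      rw [hc] at hu
      exact hu
    · rintro ⟨x, hx, rfl⟩
      exact hx
  have hinj : Function.Injective (fun (x : M) (_ : Fin 1) => x) := fun x y hxy => congrFun hxy 0
  refine (congrArg (A.Definable L) (ext fun v => ?_)).mpr (hS.natCast_lt_encard K)
  rw [mem_ofPred_eq, mem_ofPred_eq]
  refine Iff.trans ?_ (iff_of_eq (congrArg (fun s : Set (Fin 1 → M) => (K : ℕ∞) < s.encard)
    (himg v).symm))
  rw [hinj.encard_image]
  constructor
  · intro hinf
    exact (ENat.natCast_lt_top K).trans_eq (Infinite.encard_eq hinf).symm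
  · intro hlt
    have := hK (Sum.elim (fun a : A₀ => (a : M)) v)
    simp only [Formula.realize_relabel, hrel] at this
    exact this hlt

end Elimination

/-! ### Generic copies of tuples. -/

section Generic

variable {L : FirstOrder.Language.{u, v}} {M : Type w} [L.Structure M]

/-- A definable set containing an independent tuple contains tuples independent over any given
small set. -/
theorem exists_generic {κ : Cardinal.{w}} (hκ : ℵ₀ < κ) (hsat : IsSaturated L M κ)
    (hel : EliminatesExistsInfty L M) {P Q : Set M} (hQ : #Q < κ) (m : ℕ) :
    ∀ (S : Set (Fin m → M)), P.Definable L S → ∀ t ∈ S,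
      (∀ i, t i ∉ acl L (P ∪ t '' Iio i)) → ∃ z ∈ S, ∀ i, z i ∉ acl L (Q ∪ z '' Iio i) := by
  induction m with
  | zero => exact fun S _ t ht _ => ⟨t, ht, fun i => i.elim0⟩
  | succ m ih =>
    intro S hS t ht hind
    let R : Set (Fin m ⊕ Fin 1 → M) := (fun w => w ∘ finSumFinEquiv.symm) ⁻¹' S
    have hR : P.Definable L R := hS.preimage_comp _
    have hRS : ∀ (x : Fin m → M) (u : Fin 1 → M), Sum.elim x u ∈ R ↔
        (Fin.snoc x (u 0) : Fin (m + 1) → M) ∈ S := by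
      intro x u
      refine iff_of_eq (congrArg (· ∈ S) (funext fun i => ?_))
      refine Fin.lastCases ?_ (fun i => ?_) i
      · have : finSumFinEquiv.symm (Fin.last m) = (Sum.inr 0 : Fin m ⊕ Fin 1) := by
          rw [Equiv.symm_apply_eq]; rfl
        simp [this]
      · have : finSumFinEquiv.symm (Fin.castSucc i) = (Sum.inl i : Fin m ⊕ Fin 1) := by
          rw [Equiv.symm_apply_eq]; rfl
        simp [this]
    have himg : ∀ (x : Fin m → M) (y : M) (i : Fin m),
        (Fin.snoc x y : Fin (m + 1) → M) '' Iio i.castSucc = x '' Iio i := by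
      intro x y i
      ext w
      constructor
      · rintro ⟨j, hj, rfl⟩
        have hj' : j ≠ Fin.last m := ne_of_lt (lt_trans hj (Fin.castSucc_lt_last i))
        obtain ⟨j, rfl⟩ := Fin.exists_castSucc_eq.2 hj'
        exact ⟨j, Fin.castSucc_lt_castSucc_iff.1 hj, by simp⟩
      · rintro ⟨j, hj, rfl⟩
        exact ⟨j.castSucc, Fin.castSucc_lt_castSucc_iff.2 hj, by simp⟩
    have hlast : ∀ (x : Fin m → M) (y : M),
        (Fin.snoc x y : Fin (m + 1) → M) '' Iio (Fin.last m) = range x := by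
      intro x y
      ext w
      constructor
      · rintro ⟨j, hj, rfl⟩
        obtain ⟨j, rfl⟩ := Fin.exists_castSucc_eq.2 (ne_of_lt hj)
        exact ⟨j, by simp⟩
      · rintro ⟨j, rfl⟩
        exact ⟨j.castSucc, Fin.castSucc_lt_last j, by simp⟩
    obtain ⟨t', y, rfl⟩ : ∃ (t' : Fin m → M) (y : M), t = Fin.snoc t' y :=
      ⟨Fin.init t, t (Fin.last m), (Fin.snoc_init_self t).symm⟩
    -- The last entry of `t` is not algebraic over the others, so its fiber is infinite. Having an
    -- infinite fiber is a definable condition on the first `m` entries, to which the induction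
    -- hypothesis applies.
    have hinf : {x : M | Sum.elim t' (fun _ => x) ∈ R}.Infinite := by
      intro hfin
      refine hind (Fin.last m) ?_
      rw [hlast, Fin.snoc_last]
      refine mem_acl_of_definable_fiber hR ((hfin.image fun x _ => x).subset ?_) ((hRS _ _).2 ht)
      intro u hu
      have hc : (fun _ => u 0) = u := funext fun i => by rw [Subsingleton.elim i 0]
      exact ⟨u 0, by rw [mem_ofPred_eq, hc]; exact hu, hc⟩
    obtain ⟨x, hx, hxi⟩ := ih _ (hel.definable_setOf_infinite hR) t' hinf fun i => by
      have := hind i.castSucc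
      rwa [himg, Fin.snoc_castSucc] at this
    have hQ' : #(Q ∪ range x : Set M) < κ := (Cardinal.mk_union_le _ _).trans_lt
      (Cardinal.add_lt_of_lt hκ.le hQ ((Cardinal.lt_aleph0_of_finite _).trans hκ))
    have hdef : (univ : Set M).Definable₁ L {y | Sum.elim x (fun _ => y) ∈ R} := by
      refine (congrArg (univ.Definable L) (ext fun u => ?_)).mpr
        (hR.fiber (subset_univ _) (z := x) fun _ => mem_univ _)
      simp only [mem_ofPred_eq, hRS]
    obtain ⟨y', hy', hyQ⟩ := exists_notMem_acl_of_infinite hκ hsat hdef hx hQ'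
    refine ⟨Fin.snoc x y', (hRS _ _).1 hy', fun i => ?_⟩
    refine Fin.lastCases ?_ (fun i => ?_) i
    · rwa [hlast, Fin.snoc_last]
    · rw [himg, Fin.snoc_castSucc]
      exact hxi i

/-- A generic copy of a tuple `y₀`, satisfying a given property over `P`, preserves
non-algebraicity over the sets containing `D`. -/
theorem exists_generic_copy {κ : Cardinal.{w}} (hκ : ℵ₀ < κ) (hsat : IsSaturated L M κ)
    (hex : Exchange L M) (hel : EliminatesExistsInfty L M) {P Q D : Set M} (hQ : #Q < κ)
    (hDP : D ⊆ P) {d : ℕ} {E : Set (Fin d → M)} (hE : P.Definable L E) {y₀ : Fin d → M}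
    (hy₀ : y₀ ∈ E) {t : Finset M} (ht : (t : Set M) ⊆ range y₀) (hspan : range y₀ ⊆ acl L (t ∪ D))
    (hind : ∀ x ∈ t, x ∉ acl L ((t : Set M) \ {x} ∪ P)) (hne : ¬ range y₀ ⊆ acl L D) :
    ∃ y ∈ E, ¬ range y ⊆ acl L Q ∧
      ∀ Z, D ⊆ Z → Z ⊆ acl L Q → ∀ u ∈ acl L Q, u ∉ acl L Z → u ∉ acl L (Z ∪ range y) := by
  set m := t.card
  let e : t ≃ Fin m := t.equivFin
  let τ : Fin m → M := fun i => e.symm i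
  have hτ : range τ = t := by
    ext x
    exact ⟨by rintro ⟨i, rfl⟩; exact (e.symm i).2, fun hx => ⟨e ⟨x, hx⟩, by simp [τ]⟩⟩
  have hτinj : Function.Injective τ := Subtype.val_injective.comp e.symm.injective
  choose idx hidx using fun i => ht (e.symm i).2
  -- These families have finite fibers everywhere, so imposing them on a copy forces it to be
  -- algebraic over `D` and its entries corresponding to `t`.
  choose R hR hRτ hRfin using fun l => exists_definable_finite_fibers (L := L) (A := D) (τ := τ)
    (x := y₀ l) (by rw [hτ, union_comm]; exact hspan (mem_range_self l))
  have hdef : P.Definable L {w : Fin m ⊕ Fin d → M | w ∘ Sum.inr ∈ E ∧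
      (∀ i, w (Sum.inl i) = w (Sum.inr (idx i))) ∧
      ∀ l, w ∘ Sum.map id (fun _ : Fin 1 => l) ∈ R l} := by
    refine (hE.preimage_comp Sum.inr).inter (Definable.inter
      (f := {w | ∀ i, w (Sum.inl i) = w (Sum.inr (idx i))})
      (g := {w | ∀ l, w ∘ Sum.map id (fun _ : Fin 1 => l) ∈ R l}) ?_ ?_)
    · rw [ofPred_forall]
      refine definable_iInter_of_finite fun i => ?_
      exact DefinableFun.ofPred_eq (DefinableFun.proj L) (DefinableFun.proj L)
    · rw [ofPred_forall]
      exact definable_iInter_of_finite fun l => ((hR l).mono hDP).preimage_comp _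
  have hsum : ∀ (z : Fin m → M) (y : Fin d → M) (l : Fin d),
      Sum.elim z y ∘ Sum.map id (fun _ : Fin 1 => l) = Sum.elim z fun _ => y l := by
    intro z y l
    ext i
    rcases i <;> rfl
  obtain ⟨z, ⟨y, hyE, hzy, hyR⟩, hz⟩ := exists_generic hκ hsat hel hQ m _ hdef.exists_of_finite τ
    ⟨y₀, hy₀, fun i => (hidx i).symm, fun l => by rw [hsum]; exact hRτ l⟩ fun i hi => by
      refine hind (τ i) (e.symm i).2 (acl_mono ?_ hi)
      rw [union_comm]
      refine union_subset_union_left _ ?_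
      rintro _ ⟨j, hj, rfl⟩
      exact ⟨(e.symm j).2, fun h => (ne_of_lt hj) (hτinj h)⟩
  replace hzy : ∀ i, z i = y (idx i) := hzy
  have hyz : range y ⊆ acl L (D ∪ range z) := by
    rintro _ ⟨l, rfl⟩
    have := hyR l
    rw [hsum] at this
    exact mem_acl_of_definable_fiber (hR l) (hRfin l z) this
  refine ⟨y, hyE, fun h => ?_, fun Z hDZ hZQ u hu huZ huy => ?_⟩
  · rcases Nat.eq_zero_or_pos m with hm | hm
    · refine hne (hspan.trans (acl_mono ?_))
      rw [Finset.card_eq_zero.1 hm]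
      simp
    · refine hz ⟨0, hm⟩ (acl_mono subset_union_left (h ⟨idx ⟨0, hm⟩, (hzy _).symm⟩))
  -- If `u` became algebraic on adding some `z k`, exchange would make `z k` algebraic over `Q` and
  -- the earlier entries, against genericity.
  · have key : ∀ k ≤ m, u ∉ acl L (Z ∪ z '' {i | i.1 < k}) := by
      intro k
      induction k with
      | zero => simpa using huZ
      | succ k ih =>
        intro hk hmem
        have heq : Z ∪ z '' {i | i.1 < k + 1} = insert (z ⟨k, hk⟩) (Z ∪ z '' {i | i.1 < k}) := by
          rw [← union_insert, ← image_insert_eq]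
          congr 2
          ext i
          simp only [mem_ofPred_eq, mem_insert_iff, Fin.ext_iff]
          omega
        rw [heq] at hmem
        refine hz ⟨k, hk⟩ (mem_acl_of_subset (hex _ _ _ hmem (ih (Nat.le_of_succ_le hk))) ?_)
        have hQs : acl L Q ⊆ acl L (Q ∪ z '' Iio ⟨k, hk⟩) := acl_mono subset_union_left
        refine insert_subset (hQs hu) (union_subset (hZQ.trans hQs) ?_)
        exact Subset.trans subset_union_right subset_acl
    refine key m le_rfl (mem_acl_of_subset huy ?_)
    have hr : range z = z '' {i | i.1 < m} := by
      rw [← image_univ]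
      congr 1
      ext i
      simp
    rw [← hr]
    exact union_subset (subset_union_left.trans subset_acl)
      (hyz.trans (acl_mono (union_subset_union_left _ hDZ)))

/-- Iterating `exists_generic_copy`. -/
theorem exists_generic_copies {κ : Cardinal.{w}} (hκ : ℵ₀ < κ) (hsat : IsSaturated L M κ)
    (hex : Exchange L M) (hel : EliminatesExistsInfty L M) {P Q D : Set M} (hQ : #Q < κ)
    (hDP : D ⊆ P) {d : ℕ} {E : Set (Fin d → M)} (hE : P.Definable L E) {y₀ : Fin d → M}
    (hy₀ : y₀ ∈ E) {t : Finset M} (ht : (t : Set M) ⊆ range y₀) (hspan : range y₀ ⊆ acl L (t ∪ D))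
    (hind : ∀ x ∈ t, x ∉ acl L ((t : Set M) \ {x} ∪ P)) (hne : ¬ range y₀ ⊆ acl L D) (k : ℕ) :
    ∃ Y : Finset (Fin d → M), Y.card = k ∧ (Y : Set (Fin d → M)) ⊆ E ∧
      ∀ Z, D ⊆ Z → Z ⊆ acl L Q → ∀ u ∈ acl L Q, u ∉ acl L Z →
        u ∉ acl L (Z ∪ ⋃ y ∈ Y, range y) := by
  classical
  induction k with
  | zero => exact ⟨∅, rfl, by simp, by simp⟩
  | succ k ih =>
    obtain ⟨Y, hYk, hYE, hY⟩ := ih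
    have hfin : (⋃ y ∈ Y, range y).Finite := Y.finite_toSet.biUnion fun y _ => finite_range y
    have hQ' : #(Q ∪ ⋃ y ∈ Y, range y : Set M) < κ := (Cardinal.mk_union_le _ _).trans_lt
      (Cardinal.add_lt_of_lt hκ.le hQ (hfin.lt_aleph0.trans hκ))
    -- The new copy is generic over `Q` together with the earlier copies, which makes it distinct
    -- from them.
    obtain ⟨y, hyE, hyQ, hy⟩ :=
      exists_generic_copy hκ hsat hex hel hQ' hDP hE hy₀ ht hspan hind hne
    have hyY : y ∉ Y := fun h => hyQ (Subset.trans (Subset.trans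
      (subset_biUnion_of_mem (u := fun y : Fin d → M => range y) h) subset_union_right) subset_acl)
    refine ⟨insert y Y, by rw [Finset.card_insert_of_notMem hyY, hYk], ?_, ?_⟩
    · rw [Finset.coe_insert]
      exact insert_subset hyE hYE
    · intro Z hDZ hZQ u hu huZ
      have hQs : acl L Q ⊆ acl L (Q ∪ ⋃ y ∈ Y, range y) := acl_mono subset_union_left
      have := hy (Z ∪ ⋃ y ∈ Y, range y) (hDZ.trans subset_union_left)
        (union_subset (hZQ.trans hQs) (Subset.trans subset_union_right subset_acl)) u (hQs hu)
        (hY Z hDZ hZQ u hu huZ)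
      rwa [union_assoc, union_comm (⋃ y ∈ Y, range y), ← Finset.set_biUnion_insert] at this

end Generic

end GeometricTheory

namespace GeometricTheory

open Set FirstOrder.Language

/-! ### Large grids from weak local modularity. -/

section Grids

variable {L : FirstOrder.Language.{u, v}} {M : Type w} [L.Structure M]

/-- The entries of the tuples in a finite set of tuples. -/
def entries {d : ℕ} (Y : Finset (Fin d → M)) : Set M := ⋃ y ∈ Y, range y

theorem finite_entries {d : ℕ} (Y : Finset (Fin d → M)) : (entries Y).Finite :=
  Y.finite_toSet.biUnion fun y _ => finite_range y

theorem range_subset_entries {d : ℕ} {Y : Finset (Fin d → M)} {y : Fin d → M} (hy : y ∈ Y) :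
    range y ⊆ entries Y :=
  subset_biUnion_of_mem (u := fun y : Fin d → M => range y) hy

theorem entries_singleton {d : ℕ} (y : Fin d → M) : entries {y} = range y := by
  simp [entries]

variable {r : ℕ} {d : Fin r → ℕ}

open Classical in
/-- The fiber over all coordinates except `i₀`, of the points of a grid. -/
theorem definable_fiber_grid {P P₀ : Set M} {E : Set (∀ i, Fin (d i) → M)}
    (hE : P₀.Definable L {w : (Σ i, Fin (d i)) → M | (fun i l => w ⟨i, l⟩) ∈ E})
    (C : ∀ i, Finset (Fin (d i) → M)) (i₀ : Fin r) (hP : P₀ ⊆ P)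
    (hC : ∀ j ≠ i₀, entries (C j) ⊆ P) :
    P.Definable L {y | ∀ x ∈ Fintype.piFinset C, Function.update x i₀ y ∈ E} := by
  have heq : {y | ∀ x ∈ Fintype.piFinset C, Function.update x i₀ y ∈ E} =
      ⋂ x ∈ Fintype.piFinset C, {y | Function.update x i₀ y ∈ E} := by
    ext y
    simp
  rw [heq]
  have : ∀ x ∈ Fintype.piFinset C, P.Definable L {y | Function.update x i₀ y ∈ E} := by
    intro x hx
    refine Definable.preimage_map
      (F := fun (y : Fin (d i₀) → M) (p : Σ i, Fin (d i)) => Function.update x i₀ y p.1 p.2)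
      ?_ (hE.mono hP)
    rintro ⟨i, l⟩
    by_cases hi : i = i₀
    · subst hi
      simp only [Function.update_self]
      exact DefinableFun.proj L
    · simp only [Function.update_of_ne hi]
      exact definableFun_const L _
        (hC i hi (range_subset_entries (Fintype.mem_piFinset.1 hx i) (mem_range_self l)))
  have h2 := definable_biInter_finset (A := P) (L := L)
    (f := fun x : Fintype.piFinset C => {y | Function.update x.1 i₀ y ∈ E})
    (fun x => this x.1 x.2) Finset.univ
  refine (congrArg (P.Definable L) (ext fun y => ?_)).mpr h2
  simp

open Classical in
/-- One factor of a grid, consisting of a single tuple, can be replaced by a set of `k` tuples. -/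
theorem exists_grid_replace {κ : Cardinal.{w}} (hκ : ℵ₀ < κ) (hsat : IsSaturated L M κ)
    (hex : Exchange L M) (hel : EliminatesExistsInfty L M)
    (hw : ∀ A B : Set M, #A < κ → #B < κ → ∃ C : Set M, #C < κ ∧ Indep L C ∅ (A ∪ B) ∧
      Indep L A (acl L (A ∪ C) ∩ acl L (B ∪ C)) B)
    {P₀ : Set M} (hP₀ : P₀.Finite) {E : Set (∀ i, Fin (d i) → M)}
    (hE : P₀.Definable L {w : (Σ i, Fin (d i)) → M | (fun i l => w ⟨i, l⟩) ∈ E})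
    (k : ℕ) (a : ∀ i, Fin (d i) → M) (s : Finset (Fin r)) (C : ∀ i, Finset (Fin (d i) → M))
    {i₀ : Fin r} (hi₀ : i₀ ∈ s) (hCa : ∀ i ∈ s, C i = {a i}) (hCE : Grid.prod C ⊆ E)
    (hacl : ∀ i ∈ s, ∃ l, a i l ∉ acl L (P₀ ∪ ⋃ j ≠ i, entries (C j))) :
    ∃ Y : Finset (Fin (d i₀) → M), Y.card = k ∧ Grid.prod (Function.update C i₀ Y) ⊆ E ∧
      ∀ i ∈ s, i ≠ i₀ →
        ∃ l, a i l ∉ acl L (P₀ ∪ ⋃ j ≠ i, entries (Function.update C i₀ Y j)) := by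
  have hsmall : ∀ {X : Set M}, X.Finite → #X < κ := fun h => h.lt_aleph0.trans hκ
  have hadd : ∀ {X Y : Set M}, #X < κ → #Y < κ → #(X ∪ Y : Set M) < κ := fun hX hY =>
    (Cardinal.mk_union_le _ _).trans_lt (Cardinal.add_lt_of_lt hκ.le hX hY)
  -- `A` collects `a i₀` and the factors already replaced, `B` everything except `a i₀`. Hence the
  -- parameters and the replaced factors lie in both, and so in `D`.
  set A : Set M := P₀ ∪ ⋃ j ∈ {j | j ∉ s.erase i₀}, entries (C j) with hA
  set B : Set M := P₀ ∪ ⋃ j ≠ i₀, entries (C j) with hB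
  have hAfin : A.Finite := hP₀.union ((toFinite _).biUnion fun j _ => finite_entries _)
  have hBfin : B.Finite :=
    hP₀.union (Finite.biUnion (toFinite {j | j ≠ i₀}) fun j _ => finite_entries _)
  obtain ⟨F, hF, hFind, hAB⟩ := hw A B (hsmall hAfin) (hsmall hBfin)
  set D := acl L (A ∪ F) ∩ acl L (B ∪ F)
  have hentA : ∀ j, j ∉ s.erase i₀ → entries (C j) ⊆ A := fun j hj =>
    Subset.trans (subset_biUnion_of_mem (u := fun j => entries (C j)) hj) subset_union_right
  have hentB : ∀ j, j ≠ i₀ → entries (C j) ⊆ B := fun j hj =>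
    Subset.trans (subset_biUnion_of_mem (u := fun j => entries (C j)) (show j ∈ {j | j ≠ i₀} from hj))
      subset_union_right
  have hA_D : ∀ X : Set M, X ⊆ A → X ⊆ B → X ⊆ D := fun X h1 h2 =>
    subset_inter ((h1.trans subset_union_left).trans subset_acl)
      ((h2.trans subset_union_left).trans subset_acl)
  have hi₀ent : entries (C i₀) = range (a i₀) := by rw [hCa i₀ hi₀, entries_singleton]
  have haA : range (a i₀) ⊆ A := hi₀ent ▸ hentA i₀ (Finset.notMem_erase _ _)
  -- Weak local modularity enters here: a basis of `a i₀` over `D` stays independent over `B ∪ D`,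
  -- and the condition for enlarging the grid is definable over `B`.
  obtain ⟨t, hts, hspan, hind⟩ := exists_basis_of_dim_eq (hAB (Finset.univ.image (a i₀))
    (by simpa using haA))
  rw [Finset.coe_image, Finset.coe_univ, image_univ] at hspan
  have hne : ¬ range (a i₀) ⊆ acl L D := by
    intro h
    obtain ⟨l, hl⟩ := hacl i₀ hi₀
    refine hl (mem_acl_of_indep_empty hex hFind subset_union_right
      (Or.inl (haA (mem_range_self l))) ?_)
    exact mem_acl_of_subset (h (mem_range_self l)) inter_subset_right
  have haE : a i₀ ∈ {y | ∀ x ∈ Fintype.piFinset C, Function.update x i₀ y ∈ E} := by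
    intro x hx
    refine hCE fun i => ?_
    by_cases hi : i = i₀
    · subst hi
      rw [Function.update_self, hCa i hi₀]
      exact Finset.mem_singleton_self _
    · rw [Function.update_of_ne hi]
      exact Fintype.mem_piFinset.1 hx i
  obtain ⟨Y, hYk, hYE, hY⟩ := exists_generic_copies hκ hsat hex hel
    (Q := A ∪ B ∪ F) (hadd (hadd (hsmall hAfin) (hsmall hBfin)) hF)
    (subset_union_right : D ⊆ B ∪ D) (definable_fiber_grid hE C i₀
      (subset_union_left.trans subset_union_left : P₀ ⊆ B ∪ D)
      fun j hj => (hentB j hj).trans subset_union_left) haE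
    (by simpa using Finset.coe_subset.2 hts) hspan hind hne k
  refine ⟨Y, hYk, ?_, ?_⟩
  · intro x hx
    have hx₀ : x i₀ ∈ Y := by simpa using hx i₀
    have := hYE hx₀ (Function.update x i₀ (a i₀)) (Fintype.mem_piFinset.2 fun i => ?_)
    · simpa using this
    · by_cases hi : i = i₀
      · subst hi
        rw [Function.update_self, hCa i hi₀]
        exact Finset.mem_singleton_self _
      · rw [Function.update_of_ne hi]
        simpa [Function.update_of_ne hi] using hx i
  · intro i hi hii₀
    obtain ⟨l, hl⟩ := hacl i hi
    refine ⟨l, fun hmem => ?_⟩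
    have hia : a i l ∈ B := hentB i hii₀ (by
      rw [hCa i hi, entries_singleton]; exact mem_range_self l)
    set W : Set M := ⋃ j ∈ {j | j ∈ s.erase i₀ ∧ j ≠ i}, entries (C j)
    have hWB : W ⊆ B := iUnion₂_subset fun j hj => hentB j (Finset.ne_of_mem_erase hj.1)
    have hDQ : D ⊆ acl L (A ∪ B ∪ F) := inter_subset_left.trans
      (acl_mono (union_subset_union_left _ subset_union_left))
    -- The copies cannot make `a i l` algebraic over `W ∪ D`. It was not so before: `D` lies in the
    -- closure of `A ∪ F`, the set `F` is independent from `A ∪ B`, and `W ∪ A` involves only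
    -- components other than `i`.
    refine hY (W ∪ D) subset_union_right (union_subset ?_ hDQ) (a i l) ?_ ?_
      (acl_mono ?_ hmem)
    · exact hWB.trans ((subset_union_right.trans subset_union_left).trans subset_acl)
    · exact subset_acl (Or.inl (Or.inr hia))
    · intro h
      have hle : W ∪ A ⊆ P₀ ∪ ⋃ j ≠ i, entries (C j) := by
        refine union_subset ?_ (union_subset subset_union_left ?_)
        · refine (iUnion₂_subset fun j hj => ?_).trans subset_union_right
          exact subset_biUnion_of_mem (u := fun j => entries (C j)) (show j ∈ {j | j ≠ i} from hj.2)
        · refine (iUnion₂_subset fun j hj => ?_).trans subset_union_right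
          refine subset_biUnion_of_mem (u := fun j => entries (C j)) (show j ∈ {j | j ≠ i} from ?_)
          rintro rfl
          exact hj (Finset.mem_erase.2 ⟨hii₀, hi⟩)
      refine hl (acl_mono hle (mem_acl_of_indep_empty hex hFind
        (union_subset (hWB.trans subset_union_right) subset_union_left) (Or.inr hia)
        (mem_acl_of_subset h ?_)))
      refine union_subset ((subset_union_left.trans subset_union_left).trans subset_acl) ?_
      exact inter_subset_left.trans (acl_mono (union_subset_union_left _ subset_union_right))
    · refine union_subset ?_ (iUnion₂_subset fun j hj => ?_)
      · exact (hA_D P₀ subset_union_left subset_union_left).trans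
          (subset_union_right.trans subset_union_left)
      · by_cases hji : j = i₀
        · subst hji
          rw [Function.update_self]
          exact subset_union_right
        · rw [Function.update_of_ne hji]
          refine Subset.trans ?_ subset_union_left
          by_cases hjs : j ∈ s.erase i₀
          · exact Subset.trans (subset_biUnion_of_mem (u := fun j => entries (C j))
              (show j ∈ {j | j ∈ s.erase i₀ ∧ j ≠ i} from ⟨hjs, hj⟩)) subset_union_left
          · exact (hA_D _ (hentA j hjs) (hentB j hji)).trans subset_union_right

open Classical in
/-- In a saturated model of a geometric, weakly locally modular theory, a definable relation
containing a point none of whose components is algebraic over the other ones contains arbitrarily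
large grids. -/
theorem exists_grid_of_forall_notMem_acl {κ : Cardinal.{w}} (hκ : ℵ₀ < κ)
    (hsat : IsSaturated L M κ) (hex : Exchange L M) (hel : EliminatesExistsInfty L M)
    (hw : ∀ A B : Set M, #A < κ → #B < κ → ∃ C : Set M, #C < κ ∧ Indep L C ∅ (A ∪ B) ∧
      Indep L A (acl L (A ∪ C) ∩ acl L (B ∪ C)) B)
    {P₀ : Set M} (hP₀ : P₀.Finite) {E : Set (∀ i, Fin (d i) → M)}
    (hE : P₀.Definable L {w : (Σ i, Fin (d i)) → M | (fun i l => w ⟨i, l⟩) ∈ E})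
    (k : ℕ) {a : ∀ i, Fin (d i) → M} (ha : a ∈ E)
    (hacl : ∀ i, ∃ l, a i l ∉ acl L (P₀ ∪ ⋃ j ≠ i, range (a j))) :
    ∃ C : ∀ i, Finset (Fin (d i) → M), (∀ i, (C i).card = k) ∧ Grid.prod C ⊆ E := by
  -- Here `s` is the set of factors still to be replaced.
  have key : ∀ (s : Finset (Fin r)) (C : ∀ i, Finset (Fin (d i) → M)), (∀ i ∈ s, C i = {a i}) →
      (∀ i ∉ s, (C i).card = k) → Grid.prod C ⊆ E →
      (∀ i ∈ s, ∃ l, a i l ∉ acl L (P₀ ∪ ⋃ j ≠ i, entries (C j))) →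
      ∃ C : ∀ i, Finset (Fin (d i) → M), (∀ i, (C i).card = k) ∧ Grid.prod C ⊆ E := by
    intro s
    induction s using Finset.induction with
    | empty => exact fun C _ h2 h3 _ => ⟨C, fun i => h2 i (Finset.notMem_empty i), h3⟩
    | insert i₀ s hi₀ ih =>
      intro C h1 h2 h3 h4
      obtain ⟨Y, hYk, hYE, hY⟩ := exists_grid_replace hκ hsat hex hel hw hP₀ hE k a _ C
        (Finset.mem_insert_self i₀ s) h1 h3 h4
      refine ih (Function.update C i₀ Y) (fun i hi => ?_) (fun i hi => ?_) hYE fun i hi => ?_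
      · rw [Function.update_of_ne fun h => hi₀ (by rwa [← h])]
        exact h1 i (Finset.mem_insert_of_mem hi)
      · by_cases hii : i = i₀
        · subst hii
          rwa [Function.update_self]
        · rw [Function.update_of_ne hii]
          exact h2 i fun h => (Finset.mem_insert.1 h).elim hii hi
      · exact hY i (Finset.mem_insert_of_mem hi) fun h => hi₀ (by rwa [← h])
  refine key Finset.univ (fun i => {a i}) (fun _ _ => rfl)
    (fun i hi => absurd (Finset.mem_univ i) hi) ?_ ?_
  · intro x hx
    have : x = a := funext fun i => Finset.mem_singleton.1 (hx i)
    rwa [this]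
  · simpa only [entries_singleton] using fun i _ => hacl i

end Grids

end GeometricTheory

namespace Grid

open Set FirstOrder.Language

/-! ### Counting points in grids. -/

section Counting

variable {r : ℕ} {V : Fin r → Type w}

theorem prod_eq_piFinset (B : ∀ i, Finset (V i)) : prod B = (Fintype.piFinset B : Set (∀ i, V i)) := by
  ext a
  simp [prod]

theorem finite_prod (B : ∀ i, Finset (V i)) : (prod B).Finite := by
  rw [prod_eq_piFinset]
  exact Finset.finite_toSet _

theorem sum_prod_erase_le_delta (B : ∀ i, Finset (V i)) :
    ∑ i, ∏ j ∈ Finset.univ.erase i, (B j).card ≤ delta (r - 1) B := by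
  rw [delta, ← Finset.sum_image (s := Finset.univ) (g := fun i : Fin r => Finset.univ.erase i)
    (f := fun S => ∏ j ∈ S, (B j).card)]
  · refine Finset.sum_le_sum_of_subset fun S hS => ?_
    obtain ⟨i, -, rfl⟩ := Finset.mem_image.1 hS
    rw [Finset.mem_powersetCard]
    simp
  · intro i _ j _ hij
    by_contra hne
    have : i ∈ Finset.univ.erase j := Finset.mem_erase.2 ⟨hne, Finset.mem_univ _⟩
    rw [← show Finset.univ.erase i = Finset.univ.erase j from hij] at this
    simp at this

theorem delta_of_card_eq {B : ∀ i, Finset (V i)} {k : ℕ} (hr : 1 ≤ r) (hB : ∀ i, (B i).card = k) :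
    delta (r - 1) B = r * k ^ (r - 1) := by
  have : ∀ S ∈ (Finset.univ : Finset (Fin r)).powersetCard (r - 1),
      ∏ i ∈ S, (B i).card = k ^ (r - 1) := by
    intro S hS
    rw [Finset.prod_congr rfl fun i _ => hB i, Finset.prod_const, (Finset.mem_powersetCard.1 hS).2]
  rw [delta, Finset.sum_congr rfl this, Finset.sum_const, Finset.card_powersetCard,
    Finset.card_univ, Fintype.card_fin, smul_eq_mul]
  obtain ⟨n, rfl⟩ : ∃ n, r = n + 1 := ⟨r - 1, by omega⟩
  simp [Nat.choose_succ_self_right]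

open Classical in
/-- The points of a grid lying on a line in direction `i` with few points of `E`. -/
theorem ncard_setOf_fiber_le (E : Set (∀ i, V i)) (B : ∀ i, Finset (V i)) (i : Fin r) (K : ℕ) :
    {a ∈ E ∩ prod B | {y | Function.update a i y ∈ E}.encard ≤ K}.ncard ≤
      K * ∏ j ∈ Finset.univ.erase i, (B j).card := by
  have hfin : {a ∈ E ∩ prod B | {y | Function.update a i y ∈ E}.encard ≤ K}.Finite :=
    (finite_prod B).subset fun a ha => ha.1.2
  rw [ncard_eq_toFinset_card _ hfin]
  have hcard : (Fintype.piFinset fun j : {j // j ≠ i} => B j).card =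
      ∏ j ∈ Finset.univ.erase i, (B j).card := by
    rw [Fintype.card_piFinset]
    exact (Finset.prod_subtype _ (by simp) fun j => (B j).card).symm
  rw [← hcard]
  -- Forget the `i`-th component: the points with a common image lie on one line, and if there are
  -- any, that line has at most `K` points of `E`.
  refine Finset.card_le_mul_card_image_of_maps_to (f := fun a (j : {j // j ≠ i}) => a j)
    (fun a ha => ?_) K fun c _ => ?_
  · exact Fintype.mem_piFinset.2 fun j => (hfin.mem_toFinset.1 ha).1.2 j
  · rcases Finset.eq_empty_or_nonempty (hfin.toFinset.filter
      fun a => (fun j : {j // j ≠ i} => a j) = c) with h | ⟨a₀, ha₀⟩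
    · rw [h]
      simp
    have hupd : ∀ a ∈ hfin.toFinset.filter (fun a => (fun j : {j // j ≠ i} => a j) = c),
        Function.update a₀ i (a i) = a := by
      intro a ha
      ext j
      by_cases hj : j = i
      · subst hj
        simp
      · rw [Function.update_of_ne hj]
        exact congrFun ((Finset.mem_filter.1 ha₀).2.trans (Finset.mem_filter.1 ha).2.symm) ⟨j, hj⟩
    have ha₀' := hfin.mem_toFinset.1 (Finset.mem_filter.1 ha₀).1
    rw [← Nat.cast_le (α := ℕ∞), ← encard_coe_eq_coe_finsetCard]
    refine le_trans ?_ ha₀'.2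
    refine encard_le_encard_of_injOn (f := fun a => a i) (fun a ha => ?_) fun a ha b hb hab => ?_
    · rw [mem_ofPred_eq, hupd a ha]
      exact (hfin.mem_toFinset.1 (Finset.mem_filter.1 ha).1).1.1
    · rw [← hupd a ha, ← hupd b hb]
      exact congrArg _ hab

theorem ncard_inter_prod_le (E : Set (∀ i, V i)) (B : ∀ i, Finset (V i)) (K : ℕ) :
    (E ∩ prod B).ncard ≤
      ({a ∈ E | ∀ i, (K : ℕ∞) < {y | Function.update a i y ∈ E}.encard} ∩ prod B).ncard +
        K * delta (r - 1) B := by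
  classical
  have hsub : E ∩ prod B ⊆
      ({a ∈ E | ∀ i, (K : ℕ∞) < {y | Function.update a i y ∈ E}.encard} ∩ prod B) ∪
      ⋃ i ∈ (Finset.univ : Finset (Fin r)),
        {a ∈ E ∩ prod B | {y | Function.update a i y ∈ E}.encard ≤ K} := by
    rintro a ⟨haE, haB⟩
    by_cases h : ∀ i, (K : ℕ∞) < {y | Function.update a i y ∈ E}.encard
    · exact Or.inl ⟨⟨haE, h⟩, haB⟩
    · push Not at h
      obtain ⟨i, hi⟩ := h
      exact Or.inr (mem_biUnion (Finset.mem_univ i) ⟨⟨haE, haB⟩, hi⟩)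
  refine (ncard_le_ncard hsub ?_).trans ((ncard_union_le _ _).trans (Nat.add_le_add_left ?_ _))
  · exact ((finite_prod B).subset inter_subset_right).union
      (Finite.biUnion (toFinite _) fun i _ => (finite_prod B).subset fun a ha => ha.1.2)
  · refine (Finset.set_ncard_biUnion_le _ _).trans ?_
    refine (Finset.sum_le_sum fun i _ => ncard_setOf_fiber_le E B i K).trans ?_
    rw [← Finset.mul_sum]
    exact Nat.mul_le_mul_left K (sum_prod_erase_le_delta B)

/-- A set satisfying a linear bound for grids does not contain arbitrarily large grids. -/
theorem not_forall_not_isKFree_of_le (hr : 1 ≤ r) {E : Set (∀ i, V i)} {c : ℝ}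
    (hE : ∀ B : ∀ i, Finset (V i), ((E ∩ prod B).ncard : ℝ) ≤ c * (delta (r - 1) B : ℝ)) :
    ¬ ∀ k : ℕ, ¬ IsKFree (fun _ => k) E := by
  intro h
  -- A grid of size `k` in `E` would give `k ^ r ≤ c * r * k ^ (r - 1)`, hence `k ≤ c * r`.
  obtain ⟨k, hk⟩ := exists_nat_gt (max (c * r) 0)
  have hk0 : (0 : ℝ) < k := (le_max_right _ _).trans_lt hk
  obtain ⟨C, hC, hCE⟩ := not_not.1 (h k)
  have := hE C
  rw [inter_eq_self_of_subset_right hCE, prod_eq_piFinset, ncard_coe_finset,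
    Fintype.card_piFinset, delta_of_card_eq hr hC, Finset.prod_congr rfl fun i _ => hC i,
    Finset.prod_const, Finset.card_univ, Fintype.card_fin] at this
  obtain ⟨n, rfl⟩ : ∃ n, r = n + 1 := ⟨r - 1, by omega⟩
  rw [Nat.add_sub_cancel] at this
  push_cast at this hk
  rw [pow_succ', ← mul_assoc] at this
  have h2 := le_of_mul_le_mul_right this (pow_pos hk0 n)
  exact absurd ((le_max_left _ _).trans_lt hk) (not_lt.2 h2)

end Counting

/-! ### Derivatives and grid statements as formulas. -/

section Formulas

variable {L : FirstOrder.Language.{u, v}} {r e : ℕ} {d : Fin r → ℕ}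

/-- The renaming of variables that splits off the `i`-th component. -/
def splitVar (i : Fin r) : (Σ j : Fin r, Fin (d j)) ⊕ Fin e →
    ((Σ j : Fin r, Fin (d j)) ⊕ Fin e) ⊕ Fin (d i)
  | .inl ⟨j, l⟩ => if h : j = i then .inr (h ▸ l) else .inl (.inl ⟨j, l⟩)
  | .inr l => .inl (.inr l)

theorem elim_comp_splitVar {M : Type*} (i : Fin r) (a : ∀ i, Fin (d i) → M) (b : Fin e → M)
    (y : Fin (d i) → M) :
    Sum.elim (Sum.elim (fun p : Σ j : Fin r, Fin (d j) => a p.1 p.2) b) y ∘ splitVar i =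
      Sum.elim (fun p : Σ j : Fin r, Fin (d j) => Function.update a i y p.1 p.2) b := by
  ext x
  rcases x with ⟨j, l⟩ | l
  · by_cases h : j = i
    · subst h
      simp [splitVar]
    · simp [splitVar, h]
  · rfl

/-- The formula defining the points `a` of the relation such that for every `i`, there are more
than `K` points of the relation that agree with `a` outside the `i`-th component. -/
noncomputable def derive (K : ℕ) (φ : L.Formula ((Σ i : Fin r, Fin (d i)) ⊕ Fin e)) :
    L.Formula ((Σ i : Fin r, Fin (d i)) ⊕ Fin e) :=
  φ ⊓ Formula.iInf fun i => (φ.relabel (splitVar i)).exsGT K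

theorem definedRel_derive {M : Type*} [L.Structure M] (K : ℕ)
    (φ : L.Formula ((Σ i : Fin r, Fin (d i)) ⊕ Fin e)) (b : Fin e → M) :
    definedRel (derive K φ) b = {a ∈ definedRel φ b |
      ∀ i, (K : ℕ∞) < {y | Function.update a i y ∈ definedRel φ b}.encard} := by
  ext a
  simp only [definedRel, derive, mem_ofPred_eq, Formula.realize_inf, Formula.realize_iInf,
    Formula.realize_exsGT, Formula.realize_relabel, elim_comp_splitVar]

/-- The iterated derivative, with the bounds depending on the formula. -/
noncomputable def deriveIter (K : L.Formula ((Σ i : Fin r, Fin (d i)) ⊕ Fin e) → ℕ)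
    (φ : L.Formula ((Σ i : Fin r, Fin (d i)) ⊕ Fin e)) :
    ℕ → L.Formula ((Σ i : Fin r, Fin (d i)) ⊕ Fin e)
  | 0 => φ
  | n + 1 => derive (K (deriveIter K φ n)) (deriveIter K φ n)

theorem definedRel_deriveIter_subset {M : Type*} [L.Structure M]
    (K : L.Formula ((Σ i : Fin r, Fin (d i)) ⊕ Fin e) → ℕ)
    (φ : L.Formula ((Σ i : Fin r, Fin (d i)) ⊕ Fin e)) (b : Fin e → M) (n : ℕ) :
    definedRel (deriveIter K φ n) b ⊆ definedRel φ b := by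
  induction n with
  | zero => exact subset_rfl
  | succ n ih =>
    rw [deriveIter, definedRel_derive]
    exact fun a ha => ih ha.1

theorem ncard_definedRel_inter_prod_le {M : Type w} [L.Structure M]
    (K : L.Formula ((Σ i : Fin r, Fin (d i)) ⊕ Fin e) → ℕ)
    (φ : L.Formula ((Σ i : Fin r, Fin (d i)) ⊕ Fin e)) (b : Fin e → M)
    (B : ∀ i : Fin r, Finset (Fin (d i) → M)) (n : ℕ) :
    (definedRel φ b ∩ prod B).ncard ≤ (definedRel (deriveIter K φ n) b ∩ prod B).ncard +
      (∑ m ∈ Finset.range n, K (deriveIter K φ m)) * delta (r - 1) B := by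
  induction n with
  | zero => simp [deriveIter]
  | succ n ih =>
    have := ncard_inter_prod_le (definedRel (deriveIter K φ n) b) B (K (deriveIter K φ n))
    rw [Finset.sum_range_succ, deriveIter, definedRel_derive, add_mul]
    omega

/-- The formula expressing that the relation contains a grid with factors of size `k`. -/
noncomputable def gridFormula (k : ℕ) (φ : L.Formula ((Σ i : Fin r, Fin (d i)) ⊕ Fin e)) :
    L.Formula (Fin e) :=
  Formula.iExs (Σ i : Fin r, Fin k × Fin (d i))
    ((Formula.iInf fun g : Fin r → Fin k =>
      φ.relabel (Sum.elim (fun p => Sum.inr ⟨p.1, g p.1, p.2⟩) Sum.inl)) ⊓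
    Formula.iInf fun q : {q : Fin r × Fin k × Fin k // q.2.1 ≠ q.2.2} =>
      (Formula.iInf fun l : Fin (d q.1.1) =>
        Term.equal (Term.var (Sum.inr ⟨q.1.1, q.1.2.1, l⟩))
          (Term.var (Sum.inr ⟨q.1.1, q.1.2.2, l⟩))).not)

theorem realize_gridFormula {M : Type*} [L.Structure M] (k : ℕ)
    (φ : L.Formula ((Σ i : Fin r, Fin (d i)) ⊕ Fin e)) (b : Fin e → M) :
    (gridFormula k φ).Realize b ↔
      ∃ C : ∀ i : Fin r, Finset (Fin (d i) → M), (∀ i, (C i).card = k) ∧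
        prod C ⊆ definedRel φ b := by
  classical
  have hsem : (gridFormula k φ).Realize b ↔ ∃ c : (Σ i : Fin r, Fin k × Fin (d i)) → M,
      (∀ g : Fin r → Fin k, (fun i l => c ⟨i, g i, l⟩) ∈ definedRel φ b) ∧
      ∀ i, Function.Injective fun (p : Fin k) (l : Fin (d i)) => c ⟨i, p, l⟩ := by
    rw [gridFormula, Formula.realize_iExs]
    refine exists_congr fun c => ?_
    rw [Formula.realize_inf]
    refine and_congr ?_ ?_
    · rw [Formula.realize_iInf]
      refine forall_congr' fun g => ?_
      rw [Formula.realize_relabel, definedRel, mem_ofPred_eq, iff_iff_eq]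
      congr 1
      ext x
      rcases x <;> rfl
    · simp only [Formula.realize_iInf, Formula.realize_not, Formula.realize_equal,
        Term.realize_var, Sum.elim_inr, Subtype.forall, Prod.forall]
      refine forall_congr' fun i => ⟨fun h p q hpq => ?_, fun h p q hpq h' => hpq (h (funext h'))⟩
      by_contra hne
      exact h p q hne fun l => congrFun hpq l
  rw [hsem]
  constructor
  · rintro ⟨c, hc, hinj⟩
    refine ⟨fun i => Finset.univ.image fun (p : Fin k) (l : Fin (d i)) => c ⟨i, p, l⟩,
      fun i => ?_, fun x hx => ?_⟩
    · rw [Finset.card_image_of_injective _ (hinj i), Finset.card_univ, Fintype.card_fin]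
    · choose g _ hg using fun i => Finset.mem_image.1 (hx i)
      obtain rfl : (fun i l => c ⟨i, g i, l⟩) = x := funext hg
      exact hc g
  · rintro ⟨C, hC, hCE⟩
    refine ⟨fun q => ((C q.1).equivFinOfCardEq (hC q.1)).symm q.2.1 |>.1 q.2.2, fun g => ?_,
      fun i => ?_⟩
    · exact hCE fun i => (((C i).equivFinOfCardEq (hC i)).symm (g i)).2
    · exact Subtype.val_injective.comp ((C i).equivFinOfCardEq (hC i)).symm.injective

/-- The sentence expressing that, whenever the relation defined by `ψ` is not empty, the relation
defined by `φ` with the same parameters contains a grid with factors of size `k`. -/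
noncomputable def gridSentence (k : ℕ) (ψ φ : L.Formula ((Σ i : Fin r, Fin (d i)) ⊕ Fin e)) :
    L.Sentence :=
  Formula.iAlls (Fin e) (Formula.relabel Sum.inr
    ((Formula.iExs (Σ i : Fin r, Fin (d i)) (ψ.relabel Sum.swap)).imp (gridFormula k φ)))

theorem realize_gridSentence {M : Type*} [L.Structure M] (k : ℕ)
    (ψ φ : L.Formula ((Σ i : Fin r, Fin (d i)) ⊕ Fin e)) :
    M ⊨ gridSentence k ψ φ ↔ ∀ b : Fin e → M, (definedRel ψ b).Nonempty →
      ¬ IsKFree (fun _ => k) (definedRel φ b) := by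
  rw [gridSentence, Sentence.Realize, Formula.realize_iAlls]
  refine forall_congr' fun b => ?_
  rw [Formula.realize_relabel, Sum.elim_comp_inr, Formula.realize_imp, realize_gridFormula,
    IsKFree, not_not, Formula.realize_iExs]
  refine imp_congr_left ⟨fun ⟨a, ha⟩ => ⟨fun i l => a ⟨i, l⟩, ?_⟩,
    fun ⟨a, ha⟩ => ⟨fun p => a p.1 p.2, ?_⟩⟩
  · rw [Formula.realize_relabel] at ha
    refine (congrArg ψ.Realize ?_).mp ha
    ext x
    rcases x <;> rfl
  · rw [Formula.realize_relabel]
    refine (congrArg ψ.Realize ?_).mp ha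
    ext x
    rcases x <;> rfl

end Formulas

end Grid

namespace GeometricTheory

open Set FirstOrder.Language Grid

/-! ### From a surviving derivative to a non-algebraic point. -/

section Derivative

variable {L : FirstOrder.Language.{u, v}} {M : Type w} [L.Structure M]
  {r e : ℕ} {d : Fin r → ℕ}

theorem EliminatesExistsInfty.exists_bound_definedRel (h : EliminatesExistsInfty L M)
    (φ : L.Formula ((Σ i : Fin r, Fin (d i)) ⊕ Fin e)) :
    ∃ K : ℕ, ∀ (b : Fin e → M) (a : ∀ i, Fin (d i) → M) (i : Fin r),
      (K : ℕ∞) < {y | Function.update a i y ∈ definedRel φ b}.encard →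
      ∃ l, ((fun y : Fin (d i) → M => y l) ''
        {y | Function.update a i y ∈ definedRel φ b}).Infinite := by
  choose K hK using fun i => h.exists_bound (φ.relabel (splitVar i))
  simp only [Formula.realize_relabel] at hK
  refine ⟨Finset.univ.sup K, fun b a i hlt => ?_⟩
  have := hK i (Sum.elim (fun p => a p.1 p.2) b)
  simp only [elim_comp_splitVar] at this
  refine this (lt_of_le_of_lt ?_ hlt)
  exact_mod_cast Finset.le_sup (Finset.mem_univ i)

open Classical in
/-- A point of a sufficiently high derivative yields a point of the relation none of whose
components is algebraic over the other ones. -/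
theorem exists_forall_notMem_acl_of_deriveIter {κ : Cardinal.{w}} (hκ : ℵ₀ < κ)
    (hsat : IsSaturated L M κ) (hex : Exchange L M)
    {K : L.Formula ((Σ i : Fin r, Fin (d i)) ⊕ Fin e) → ℕ}
    (hK : ∀ φ, ∀ (b : Fin e → M) (a : ∀ i, Fin (d i) → M) (i : Fin r),
      (K φ : ℕ∞) < {y | Function.update a i y ∈ definedRel φ b}.encard →
      ∃ l, ((fun y : Fin (d i) → M => y l) ''
        {y | Function.update a i y ∈ definedRel φ b}).Infinite)
    (φ : L.Formula ((Σ i : Fin r, Fin (d i)) ⊕ Fin e)) (b : Fin e → M) (n : ℕ) :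
    -- `J` certifies a lower bound for the rank of `a` over `b`. Each descent by one derivative
    -- enlarges it, so its size plus the level does not decrease; at level zero it would exceed the
    -- number of entries.
    ∀ a ∈ definedRel (deriveIter K φ n) b, ∀ J : Finset M,
      J ⊆ (Finset.univ.image fun p : Σ i : Fin r, Fin (d i) => a p.1 p.2) →
      IndepSet L J (range b) → ∑ i, d i < J.card + n →
      ∃ a ∈ definedRel φ b, ∀ i, ∃ l, a i l ∉ acl L (range b ∪ ⋃ j ≠ i, range (a j)) := by
  induction n with
  | zero =>
    intro a _ J hJ _ hlt
    have := (Finset.card_le_card hJ).trans Finset.card_image_le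
    rw [Finset.card_univ, Fintype.card_sigma] at this
    simp only [Fintype.card_fin] at this
    omega
  | succ n ih =>
    intro a ha J hJa hJ hlt
    by_cases hw : ∀ i, ∃ l, a i l ∉ acl L (range b ∪ ⋃ j ≠ i, range (a j))
    · exact ⟨a, definedRel_deriveIter_subset K φ b _ ha, hw⟩
    push Not at hw
    obtain ⟨i, hi⟩ := hw
    rw [deriveIter, definedRel_derive] at ha
    obtain ⟨l, hl⟩ := hK _ b a i (ha.2 i)
    set X : Finset M := (Finset.univ.filter fun p : Σ i : Fin r, Fin (d i) => p.1 ≠ i).image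
      fun p => a p.1 p.2
    have hX : (⋃ j ≠ i, range (a j)) = (X : Set M) := by
      ext x
      simp only [X, Finset.coe_image, Finset.coe_filter, Finset.mem_univ, true_and, mem_iUnion,
        mem_range, mem_image, mem_ofPred_eq, Sigma.exists, exists_prop]
      exact exists_congr fun j => ⟨fun ⟨h1, l, h2⟩ => ⟨l, h1, h2⟩, fun ⟨l, h1, h2⟩ => ⟨h1, l, h2⟩⟩
    rw [hX] at hi
    obtain ⟨J', hJ'X, hJ', hspan⟩ := exists_indepSet_spanning hex X (range b)
    have hXJ' : range b ∪ X ⊆ acl L (J' ∪ range b) :=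
      union_subset (subset_union_right.trans subset_acl) hspan
    -- As the `i`-th component is algebraic over the others, discarding it does not lower the rank.
    have hle : J.card ≤ J'.card := by
      refine IndepSet.card_le hex J' J _ hJ fun x hx => ?_
      obtain ⟨⟨j, l'⟩, -, rfl⟩ := Finset.mem_image.1 (hJa hx)
      by_cases hj : j = i
      · subst hj
        exact mem_acl_of_subset (hi l') hXJ'
      · exact hspan (Finset.mem_image.2 ⟨⟨j, l'⟩, by simpa using hj, rfl⟩)
    have hdef : (univ : Set M).Definable₁ L ((fun y : Fin (d i) → M => y l) ''
        {y | Function.update a i y ∈ definedRel (deriveIter K φ n) b}) := by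
      have h1 : (univ : Set M).Definable L {w | (deriveIter K φ n).Realize w} :=
        (empty_definable_iff.2 ⟨_, rfl⟩).mono (empty_subset _)
      have h2 := Definable.preimage_map (F := fun y : Fin (d i) → M =>
        Sum.elim (fun p : Σ j : Fin r, Fin (d j) => Function.update a i y p.1 p.2) b) (fun p => by
          rcases p with ⟨j, l⟩ | j
          · by_cases hj : j = i
            · subst hj
              simp only [Sum.elim_inl, Function.update_self]
              exact DefinableFun.proj L
            · simp only [Sum.elim_inl, Function.update_of_ne hj]
              exact definableFun_const L _ (mem_univ _)
          · exact definableFun_const L _ (mem_univ _)) h1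
      refine (congrArg (univ.Definable L) (ext fun f => ?_)).mpr
        (h2.image_comp (fun _ : Fin 1 => l))
      constructor
      · rintro ⟨y, hy, h⟩
        refine ⟨y, hy, funext fun j => ?_⟩
        rw [Subsingleton.elim j 0]
        exact h
      · rintro ⟨y, hy, rfl⟩
        exact ⟨y, hy, rfl⟩
    have hsm : #(J' ∪ range b : Set M) < κ := (Cardinal.lt_aleph0_of_finite _).trans hκ
    -- The line through `a` is infinite in coordinate `l`, so it contains a point one level lower
    -- whose entry `y l` is new to `J'`.
    obtain ⟨_, ⟨y, hy, rfl⟩, hyl⟩ := exists_notMem_acl_of_infinite hκ hsat hdef hl hsm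
    refine ih (Function.update a i y) hy (insert (y l) J') ?_ (hJ'.insert hex hyl) ?_
    · refine Finset.insert_subset (Finset.mem_image.2 ⟨⟨i, l⟩, Finset.mem_univ _, by simp⟩)
        fun x hx => ?_
      obtain ⟨⟨j, l⟩, hj, rfl⟩ := Finset.mem_image.1 (hJ'X hx)
      have hj' : j ≠ i := (Finset.mem_filter.1 hj).2
      exact Finset.mem_image.2 ⟨⟨j, l⟩, Finset.mem_univ _, by simp [Function.update_of_ne hj']⟩
    · rw [Finset.card_insert_of_notMem fun h => hyl (subset_acl (Or.inl h))]
      omega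

end Derivative

end GeometricTheory

/-! ### The dichotomy. -/

theorem mainTheorem9 {L : FirstOrder.Language.{u, v}} (T : L.Theory)
    (hgeom : GeometricTheory.IsGeometric T) (hwlm : GeometricTheory.IsWeaklyLocallyModular T)
    (r : ℕ) (hr : 2 ≤ r) (d : Fin r → ℕ) (e : ℕ)
    (φ : L.Formula ((Σ i : Fin r, Fin (d i)) ⊕ Fin e)) :
    ∃ α : ℝ, 0 < α ∧
      ∀ (M : Type w) [L.Structure M] [Nonempty M], M ⊨ T → ∀ b : Fin e → M,
        Xor
          (∀ k : ℕ, ¬ Grid.IsKFree (fun _ => k) (Grid.definedRel φ b))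
          (∀ B : ∀ i : Fin r, Finset (Fin (d i) → M),
            ((Grid.definedRel φ b ∩ Grid.prod B).ncard : ℝ) ≤
              α * (Grid.delta (r - 1) B : ℝ)) := by
  obtain ⟨κ, hκ, hLκ, N, _, _, hN, hsat⟩ := exists_isSaturated_model hgeom.1.1
  obtain ⟨hex, hel⟩ := hgeom.2 N hN
  choose K hK using fun φ : L.Formula ((Σ i : Fin r, Fin (d i)) ⊕ Fin e) =>
    hel.exists_bound_definedRel φ
  -- One more than the largest possible rank, so that the descent can start from the empty
  -- independent set.
  set n := ∑ i, d i + 1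
  have hgrid : ∀ k, N ⊨ Grid.gridSentence k (Grid.deriveIter K φ n) φ := by
    intro k
    rw [Grid.realize_gridSentence]
    rintro b ⟨a, ha⟩
    obtain ⟨a', ha', hacl⟩ := GeometricTheory.exists_forall_notMem_acl_of_deriveIter hκ hsat hex hK
      φ b n a ha ∅ (Finset.empty_subset _) (by simp [GeometricTheory.IndepSet]) (by simp [n])
    rw [Grid.IsKFree, not_not]
    refine GeometricTheory.exists_grid_of_forall_notMem_acl hκ hsat hex hel
      (hwlm κ hκ hLκ N hN hsat) (Set.finite_range b) ?_ k ha' hacl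
    refine Set.Definable.preimage_map (F := fun w : (Σ i : Fin r, Fin (d i)) → N => Sum.elim w b)
      (fun p => ?_) (S := {w | φ.Realize w})
      ((Set.empty_definable_iff.2 ⟨φ, rfl⟩).mono (Set.empty_subset _))
    rcases p with p | j
    · exact Set.DefinableFun.proj L
    · exact FirstOrder.Language.definableFun_const L _ (Set.mem_range_self j)
  -- The summand `1` only serves to make the constant positive.
  refine ⟨∑ m ∈ Finset.range n, (K (Grid.deriveIter K φ m) : ℝ) + 1, by positivity, ?_⟩
  intro M _ _ hM b
  rcases Set.eq_empty_or_nonempty (Grid.definedRel (Grid.deriveIter K φ n) b) with hE | hE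
  · have h2 : ∀ B : ∀ i : Fin r, Finset (Fin (d i) → M),
        ((Grid.definedRel φ b ∩ Grid.prod B).ncard : ℝ) ≤
          (∑ m ∈ Finset.range n, (K (Grid.deriveIter K φ m) : ℝ) + 1) *
            (Grid.delta (r - 1) B : ℝ) := by
      intro B
      have := Grid.ncard_definedRel_inter_prod_le K φ b B n
      rw [hE, Set.empty_inter, Set.ncard_empty, zero_add] at this
      have h3 : ((Grid.definedRel φ b ∩ Grid.prod B).ncard : ℝ) ≤
          (∑ m ∈ Finset.range n, (K (Grid.deriveIter K φ m) : ℝ)) *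
            (Grid.delta (r - 1) B : ℝ) := by
        exact_mod_cast this
      refine h3.trans (mul_le_mul_of_nonneg_right ?_ (Nat.cast_nonneg _))
      linarith
    exact Or.inr ⟨h2, Grid.not_forall_not_isKFree_of_le (by omega) h2⟩
  · have h1 : ∀ k : ℕ, ¬ Grid.IsKFree (fun _ => k) (Grid.definedRel φ b) := fun k =>
      (Grid.realize_gridSentence k _ φ).1 ((hgeom.1.realize_sentence_iff _ M).2
        ((hgeom.1.realize_sentence_iff _ N).1 (hgrid k))) b hE
    exact Or.inl ⟨h1, fun h2 => Grid.not_forall_not_isKFree_of_le (by omega) h2 h1⟩
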